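/- All vector spaces are over $\mathbb{C}$. For $n\ge 2$, a \emph{LAnKe} (Lie algebra of the $n$-th kind) is a vector space $\mathcal L$ with an $n$-linear bracket $[\cdot,\dots,\cdot]:\mathcal L^n\to\mathcal L$ such that, for all $\sigma\in S_n$ and all $x_1,\dots,x_{2n-1}\in\mathcal L$, $$[x_1,\dots,x_n]=\operatorname{sgn}(\sigma)\,[x_{\sigma(1)},\dots,x_{\sigma(n)}]$$ and $$[[x_1,\dots,x_n],x_{n+1},\dots,x_{2n-1}]=\sum_{i=1}^n[x_1,\dots,x_{i-1},[x_i,x_{n+1},\dots,x_{2n-1}],x_{i+1},\dots,x_n].$$ The free LAnKe on a set $X$ is the LAnKe that is universal among LAnKes $\mathcal K$ with a map $X\to\mathcal K$. Let $\mathrm{Lie}_n(m)$ be the multilinear component of the free LAnKe on $\{1,\dots,m\}$, that is, the subspace spanned by the bracketed words that contain each letter of $\{1,\dots,m\}$ exactly once; $S_m$ acts on it by letting $\sigma$ replace every letter $x$ by $\sigma(x)$. Let $\rho_{n,3}$ be the representation of $S_{2n-1}$ on $\mathrm{Lie}_n(2n-1)$. For a partition $\lambda$ of $m$ and a bijective filling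 $t$ of its Young diagram by $1,\dots,m$, with row stabilizer $R_t$ and column stabilizer $C_t$, let $e_t=\left(\sum_{\alpha\in R_t}\alpha\right)\left(\sum_{\beta\in C_t}\operatorname{sgn}(\beta)\,\beta\right)\in\mathbb{C}S_m$. The Specht module $S^\lambda$ is the left submodule of $\mathbb{C}S_m$ spanned by $\{\tau e_t:\tau\in S_m\}$; up to isomorphism it does not depend on $t$. \textbf{Theorem (The CataLAnKe Theorem).} For every $n\ge 2$ and every choice of $t$ of shape $2^{n-1}1$ (that is, $n-1$ rows of length $2$ followed by one row of length $1$), the representation $\rho_{n,3}$ of $S_{2n-1}$ is isomorphic to the Specht module $S^{2^{n-1}1}$. Moreover both have dimension equal to the $n$-th Catalan number $\frac{1}{n+1}\binom{2n}{n}$. -/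

import Mathlib

universe u v

noncomputable section

/-- A Lie algebra of the `n`-th kind (LAnKe) over `ℂ`: a complex vector space with an `n`-linear
antisymmetric bracket satisfying the generalized Jacobi identity
`[[x₁,…,xₙ],y₂,…,yₙ] = ∑ᵢ [x₁,…,xᵢ₋₁,[xᵢ,y₂,…,yₙ],xᵢ₊₁,…,xₙ]`.
In `jacobi` the family `y` is overwritten in its first slot, so only `y₂,…,yₙ` matter. -/
class LAnKe (n : ℕ) (L : Type u) [AddCommGroup L] [Module ℂ L] where
  bracket : MultilinearMap ℂ (fun _ : Fin n => L) L
  antisymm : ∀ (σ : Equiv.Perm (Fin n)) (x : Fin n → L),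
    bracket x = Equiv.Perm.sign σ • bracket (fun i => x (σ i))
  jacobi : ∀ (h : 0 < n) (x y : Fin n → L),
    bracket (Function.update y ⟨0, h⟩ (bracket x)) =
      ∑ i, bracket (Function.update x i (bracket (Function.update y ⟨0, h⟩ (x i))))

/-- A homomorphism of LAnKes: a linear map preserving the bracket. -/
structure LAnKeHom (n : ℕ) (L : Type u) (K : Type v) [AddCommGroup L] [Module ℂ L] [LAnKe n L]
    [AddCommGroup K] [Module ℂ K] [LAnKe n K] extends L →ₗ[ℂ] K where
  map_bracket : ∀ x : Fin n → L,
    toLinearMap (LAnKe.bracket x) = LAnKe.bracket (fun i => toLinearMap (x i))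

theorem LAnKeHom.eq_of_toLinearMap {n : ℕ} {L : Type u} {K : Type v} [AddCommGroup L]
    [Module ℂ L] [LAnKe n L] [AddCommGroup K] [Module ℂ K] [LAnKe n K] {F G : LAnKeHom n L K}
    (h : F.toLinearMap = G.toLinearMap) : F = G := by
  cases F
  cases G
  congr

namespace FreeLAnKe

/-- Formal expressions in the vector space operations and an `n`-ary bracket, with letters
in `X`. -/
inductive Pre (n : ℕ) (X : Type u) : Type u
  | of (x : X) : Pre n X
  | zero : Pre n X
  | add (a b : Pre n X) : Pre n X
  | smul (c : ℂ) (a : Pre n X) : Pre n X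
  | bracket (f : Fin n → Pre n X) : Pre n X

/-- The congruence on formal expressions generated by the vector space axioms, multilinearity and
antisymmetry of the bracket, and the generalized Jacobi identity. -/
inductive Rel (n : ℕ) (X : Type u) : Pre n X → Pre n X → Prop
  | refl (a) : Rel n X a a
  | symm {a b} : Rel n X a b → Rel n X b a
  | trans {a b c} : Rel n X a b → Rel n X b c → Rel n X a c
  | add_congr {a a' b b'} : Rel n X a a' → Rel n X b b' → Rel n X (.add a b) (.add a' b')
  | smul_congr (c : ℂ) {a a'} : Rel n X a a' → Rel n X (.smul c a) (.smul c a')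
  | bracket_congr {f f' : Fin n → Pre n X} :
      (∀ i, Rel n X (f i) (f' i)) → Rel n X (.bracket f) (.bracket f')
  | add_assoc (a b c) : Rel n X (.add (.add a b) c) (.add a (.add b c))
  | add_comm (a b) : Rel n X (.add a b) (.add b a)
  | zero_add (a) : Rel n X (.add .zero a) a
  | smul_add (c : ℂ) (a b) : Rel n X (.smul c (.add a b)) (.add (.smul c a) (.smul c b))
  | add_smul (c d : ℂ) (a) : Rel n X (.smul (c + d) a) (.add (.smul c a) (.smul d a))
  | mul_smul (c d : ℂ) (a) : Rel n X (.smul (c * d) a) (.smul c (.smul d a))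
  | one_smul (a) : Rel n X (.smul 1 a) a
  | zero_smul (a) : Rel n X (.smul 0 a) .zero
  | bracket_add (f : Fin n → Pre n X) (i : Fin n) (a b) :
      Rel n X (.bracket (Function.update f i (.add a b)))
        (.add (.bracket (Function.update f i a)) (.bracket (Function.update f i b)))
  | bracket_smul (f : Fin n → Pre n X) (i : Fin n) (c : ℂ) (a) :
      Rel n X (.bracket (Function.update f i (.smul c a)))
        (.smul c (.bracket (Function.update f i a)))
  | antisymm (σ : Equiv.Perm (Fin n)) (f : Fin n → Pre n X) :
      Rel n X (.bracket f)
        (.smul ((Equiv.Perm.sign σ : ℤ) : ℂ) (.bracket (fun i => f (σ i))))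
  | jacobi (h : 0 < n) (f g : Fin n → Pre n X) :
      Rel n X (.bracket (Function.update g ⟨0, h⟩ (.bracket f)))
        ((List.ofFn fun i => Pre.bracket
          (Function.update f i (.bracket (Function.update g ⟨0, h⟩ (f i))))).foldr .add .zero)

/-- `Rel` as a setoid. -/
def relSetoid (n : ℕ) (X : Type u) : Setoid (Pre n X) :=
  ⟨Rel n X, ⟨Rel.refl, Rel.symm, Rel.trans⟩⟩

end FreeLAnKe

/-- The free LAnKe on `X`: formal expressions modulo the LAnKe axioms. -/
def FreeLAnKe (n : ℕ) (X : Type u) : Type u :=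
  Quotient (FreeLAnKe.relSetoid n X)

namespace FreeLAnKe

variable {n : ℕ} {X : Type u}

/-- The class of a formal expression. -/
def mk (a : Pre n X) : FreeLAnKe n X := Quotient.mk (relSetoid n X) a

theorem mk_eq {a b : Pre n X} (h : Rel n X a b) : mk a = mk b :=
  Quotient.sound (s := relSetoid n X) h

theorem mk_surjective (a : FreeLAnKe n X) : ∃ p : Pre n X, mk p = a := Quotient.exists_rep a

theorem mk_exact {a b : Pre n X} (h : mk a = mk b) : Rel n X a b :=
  Quotient.exact (s := relSetoid n X) h

instance : Zero (FreeLAnKe n X) := ⟨mk .zero⟩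

instance : Add (FreeLAnKe n X) :=
  ⟨Quotient.map₂ Pre.add fun _ _ h _ _ h' => Rel.add_congr h h'⟩

instance : SMul ℂ (FreeLAnKe n X) :=
  ⟨fun c => Quotient.map (Pre.smul c) fun _ _ h => Rel.smul_congr c h⟩

instance : Neg (FreeLAnKe n X) := ⟨fun a => (-1 : ℂ) • a⟩

theorem mk_zero : mk (.zero : Pre n X) = 0 := rfl
theorem mk_add (a b : Pre n X) : mk (.add a b) = mk a + mk b := rfl
theorem mk_smul (c : ℂ) (a : Pre n X) : mk (.smul c a) = c • mk a := rfl

theorem fzero_add (a : FreeLAnKe n X) : 0 + a = a := by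
  obtain ⟨a, rfl⟩ := mk_surjective a
  exact mk_eq (.zero_add a)

theorem fadd_comm (a b : FreeLAnKe n X) : a + b = b + a := by
  obtain ⟨a, rfl⟩ := mk_surjective a
  obtain ⟨b, rfl⟩ := mk_surjective b
  exact mk_eq (.add_comm a b)

theorem fneg_add (a : FreeLAnKe n X) : (-1 : ℂ) • a + a = 0 := by
  obtain ⟨a, rfl⟩ := mk_surjective a
  have h1 : mk a = (1 : ℂ) • mk a := (mk_eq (.one_smul a)).symm
  have h2 := mk_eq (.add_smul (-1) 1 a)
  have h3 := mk_eq (.zero_smul a)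
  rw [neg_add_cancel, h3] at h2
  rw [mk_add, mk_smul, mk_smul, ← h1] at h2
  exact h2.symm

instance : AddCommGroup (FreeLAnKe n X) where
  add_assoc a b c := by
    obtain ⟨a, rfl⟩ := mk_surjective a
    obtain ⟨b, rfl⟩ := mk_surjective b
    obtain ⟨c, rfl⟩ := mk_surjective c
    exact mk_eq (.add_assoc a b c)
  zero_add := fzero_add
  add_zero a := by rw [fadd_comm, fzero_add]
  add_comm := fadd_comm
  neg_add_cancel := fneg_add
  nsmul := nsmulRec
  zsmul := zsmulRec

instance : Module ℂ (FreeLAnKe n X) where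
  one_smul a := by
    obtain ⟨a, rfl⟩ := mk_surjective a
    exact mk_eq (.one_smul a)
  mul_smul c d a := by
    obtain ⟨a, rfl⟩ := mk_surjective a
    exact mk_eq (.mul_smul c d a)
  smul_zero c := by
    have h0 : (0 : FreeLAnKe n X) = (0 : ℂ) • 0 := (mk_eq (.zero_smul .zero)).symm
    have h : (c * 0) • (0 : FreeLAnKe n X) = c • ((0 : ℂ) • 0) := mk_eq (.mul_smul c 0 .zero)
    rw [mul_zero, ← h0] at h
    exact h.symm
  smul_add c a b := by
    obtain ⟨a, rfl⟩ := mk_surjective a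
    obtain ⟨b, rfl⟩ := mk_surjective b
    exact mk_eq (.smul_add c a b)
  add_smul c d a := by
    obtain ⟨a, rfl⟩ := mk_surjective a
    exact mk_eq (.add_smul c d a)
  zero_smul a := by
    obtain ⟨a, rfl⟩ := mk_surjective a
    exact mk_eq (.zero_smul a)

/-- The bracket of a family of classes, computed on representatives. -/
def br (f : Fin n → FreeLAnKe n X) : FreeLAnKe n X :=
  mk (.bracket fun i => (mk_surjective (f i)).choose)

theorem mk_bracket (f : Fin n → Pre n X) : mk (.bracket f) = br (fun i => mk (f i)) :=
  mk_eq (.bracket_congr fun i => mk_exact (mk_surjective (mk (f i))).choose_spec.symm)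

theorem exists_rep_fun (f : Fin n → FreeLAnKe n X) :
    ∃ p : Fin n → Pre n X, (fun i => mk (p i)) = f :=
  ⟨fun i => (mk_surjective (f i)).choose, funext fun i => (mk_surjective (f i)).choose_spec⟩

theorem mk_update (f : Fin n → Pre n X) (i : Fin n) (a : Pre n X) :
    (fun j => mk (Function.update f i a j)) = Function.update (fun j => mk (f j)) i (mk a) := by
  funext j
  by_cases h : j = i
  · subst h; simp
  · simp [h]

theorem mk_foldr (l : List (Pre n X)) : mk (l.foldr .add .zero) = (l.map mk).sum := by
  induction l with
  | nil => rfl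
  | cons a l ih => simp [mk_add, ih]

instance : LAnKe n (FreeLAnKe n X) where
  bracket :=
    { toFun := br
      map_update_add' := by
        intro inst f i a b
        obtain rfl : inst = instDecidableEqFin n := Subsingleton.elim _ _
        obtain ⟨f, rfl⟩ := exists_rep_fun f
        obtain ⟨a, rfl⟩ := mk_surjective a
        obtain ⟨b, rfl⟩ := mk_surjective b
        rw [← mk_add, ← mk_update, ← mk_update, ← mk_update, ← mk_bracket, ← mk_bracket,
          ← mk_bracket, ← mk_add]
        exact mk_eq (.bracket_add f i a b)
      map_update_smul' := by
        intro inst f i c a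
        obtain rfl : inst = instDecidableEqFin n := Subsingleton.elim _ _
        obtain ⟨f, rfl⟩ := exists_rep_fun f
        obtain ⟨a, rfl⟩ := mk_surjective a
        rw [← mk_smul, ← mk_update, ← mk_update, ← mk_bracket, ← mk_bracket, ← mk_smul]
        exact mk_eq (.bracket_smul f i c a) }
  antisymm σ f := by
    obtain ⟨f, rfl⟩ := exists_rep_fun f
    have h := mk_eq (.antisymm σ f)
    rw [mk_smul, mk_bracket, mk_bracket, Int.cast_smul_eq_zsmul] at h
    exact h
  jacobi h f g := by
    obtain ⟨f, rfl⟩ := exists_rep_fun f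
    obtain ⟨g, rfl⟩ := exists_rep_fun g
    have H := mk_eq (.jacobi h f g)
    rw [mk_foldr, List.map_ofFn, List.sum_ofFn] at H
    simp only [Function.comp_def, mk_bracket, mk_update] at H
    exact H

/-- The canonical map from the generators. -/
def of (n : ℕ) {X : Type u} (x : X) : FreeLAnKe n X := mk (.of x)

theorem bracket_mk (f : Fin n → Pre n X) :
    LAnKe.bracket (fun i => mk (f i)) = mk (.bracket f) := (mk_bracket f).symm

section lift

variable {K : Type v} [AddCommGroup K] [Module ℂ K] [LAnKe n K]

/-- Evaluation of formal expressions in a LAnKe. -/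
def Pre.eval (φ : X → K) : Pre n X → K
  | .of x => φ x
  | .zero => 0
  | .add a b => a.eval φ + b.eval φ
  | .smul c a => c • a.eval φ
  | .bracket f => LAnKe.bracket (fun i => (f i).eval φ)

theorem Pre.eval_update (φ : X → K) (f : Fin n → Pre n X) (i : Fin n) (a : Pre n X) :
    (fun j => (Function.update f i a j).eval φ) =
      Function.update (fun j => (f j).eval φ) i (a.eval φ) := by
  funext j
  by_cases h : j = i
  · subst h; simp
  · simp [h]

theorem Pre.eval_foldr (φ : X → K) (l : List (Pre n X)) :
    (l.foldr Pre.add Pre.zero).eval φ = (l.map (Pre.eval φ)).sum := by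
  induction l with
  | nil => rfl
  | cons a l ih => simp [Pre.eval, ih]

theorem Rel.eval_eq (φ : X → K) {a b : Pre n X} (h : Rel n X a b) : a.eval φ = b.eval φ := by
  induction h with
  | refl a => rfl
  | symm _ ih => exact ih.symm
  | trans _ _ ih ih' => exact ih.trans ih'
  | add_congr _ _ ih ih' => simp only [Pre.eval, ih, ih']
  | smul_congr c _ ih => simp only [Pre.eval, ih]
  | bracket_congr _ ih => simp only [Pre.eval, ih]
  | add_assoc a b c => simp only [Pre.eval, _root_.add_assoc]
  | add_comm a b => simp only [Pre.eval, _root_.add_comm]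
  | zero_add a => simp only [Pre.eval, _root_.zero_add]
  | smul_add c a b => simp only [Pre.eval, _root_.smul_add]
  | add_smul c d a => simp only [Pre.eval, _root_.add_smul]
  | mul_smul c d a => simp only [Pre.eval, SemigroupAction.mul_smul]
  | one_smul a => simp only [Pre.eval, _root_.one_smul]
  | zero_smul a => simp only [Pre.eval, _root_.zero_smul]
  | bracket_add f i a b =>
    simp only [Pre.eval, Pre.eval_update, MultilinearMap.map_update_add]
  | bracket_smul f i c a =>
    simp only [Pre.eval, Pre.eval_update, MultilinearMap.map_update_smul]
  | antisymm σ f =>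
    simp only [Pre.eval, Int.cast_smul_eq_zsmul]
    exact LAnKe.antisymm σ _
  | jacobi h f g =>
    simp only [Pre.eval, Pre.eval_update, Pre.eval_foldr, List.map_ofFn, List.sum_ofFn,
      Function.comp_def]
    exact LAnKe.jacobi h _ _

/-- The LAnKe homomorphism out of the free LAnKe extending a map on generators. -/
def lift (φ : X → K) : LAnKeHom n (FreeLAnKe n X) K where
  toFun := Quotient.lift (Pre.eval φ) fun _ _ h => Rel.eval_eq φ h
  map_add' a b := by
    obtain ⟨a, rfl⟩ := mk_surjective a
    obtain ⟨b, rfl⟩ := mk_surjective b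
    rfl
  map_smul' c a := by
    obtain ⟨a, rfl⟩ := mk_surjective a
    rfl
  map_bracket f := by
    obtain ⟨f, rfl⟩ := exists_rep_fun f
    rw [bracket_mk]
    rfl

theorem lift_of (φ : X → K) (x : X) : (lift φ).toLinearMap (of n x) = φ x := rfl

/-- The universal property of the free LAnKe. -/
theorem existsUnique_lift (φ : X → K) :
    ∃! F : LAnKeHom n (FreeLAnKe n X) K, ∀ x, F.toLinearMap (of n x) = φ x := by
  refine ⟨lift φ, lift_of φ, fun F hF => ?_⟩
  have key : ∀ p : Pre n X, F.toLinearMap (mk p) = p.eval φ := by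
    intro p
    induction p with
    | of x => exact hF x
    | zero => exact map_zero F.toLinearMap
    | add a b iha ihb => rw [mk_add, map_add, iha, ihb]; rfl
    | smul c a ih => rw [mk_smul, map_smul, ih]; rfl
    | bracket f ih => rw [← bracket_mk, F.map_bracket]; simp only [ih]; rfl
  have h : F.toLinearMap = (lift φ).toLinearMap := by
    ext a
    obtain ⟨p, rfl⟩ := mk_surjective a
    exact key p
  exact LAnKeHom.eq_of_toLinearMap h

end lift

/-- Two LAnKe homomorphisms out of the free LAnKe agreeing on generators have the same underlying
linear map. -/
theorem hom_ext {K : Type v} [AddCommGroup K] [Module ℂ K] [LAnKe n K]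
    (F G : LAnKeHom n (FreeLAnKe n X) K)
    (h : ∀ x, F.toLinearMap (of n x) = G.toLinearMap (of n x)) :
    F.toLinearMap = G.toLinearMap := by
  have hFG : F = G := (existsUnique_lift fun x => G.toLinearMap (of n x)).unique h fun _ => rfl
  rw [hFG]

/-- The action of a permutation of the letters on the free LAnKe: the unique LAnKe homomorphism
sending each generator `x` to the generator `σ x`. -/
def permHom (n : ℕ) {X : Type u} (σ : Equiv.Perm X) :
    LAnKeHom n (FreeLAnKe n X) (FreeLAnKe n X) :=
  lift fun x => of n (σ x)

theorem permHom_of (σ : Equiv.Perm X) (x : X) :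
    (permHom n σ).toLinearMap (of n x) = of n (σ x) := rfl

/-- The representation of the group of permutations of `X` on the free LAnKe on `X` by
replacing every letter `x` by `σ x`. -/
def permRep (n : ℕ) (X : Type u) : Representation ℂ (Equiv.Perm X) (FreeLAnKe n X) where
  toFun σ := (permHom n σ).toLinearMap
  map_one' := hom_ext (permHom n 1) ⟨LinearMap.id, fun _ => rfl⟩ fun _ => rfl
  map_mul' σ τ := hom_ext (permHom n (σ * τ))
    ⟨(permHom n σ).toLinearMap ∘ₗ (permHom n τ).toLinearMap, fun x => by
      simp only [LinearMap.comp_apply, LAnKeHom.map_bracket]⟩ fun _ => rfl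

/-- Bracketed words in the letters `X`, with `n`-ary brackets. -/
inductive Word (n : ℕ) (X : Type u) : Type u
  | letter (x : X) : Word n X
  | bracket (w : Fin n → Word n X) : Word n X

/-- The number of occurrences of the letter `x` in a bracketed word. -/
def Word.count [DecidableEq X] (x : X) : Word n X → ℕ
  | .letter y => if y = x then 1 else 0
  | .bracket w => ∑ i, (w i).count x

/-- The element of the free LAnKe represented by a bracketed word. -/
def Word.eval : Word n X → FreeLAnKe n X
  | .letter x => of n x
  | .bracket w => LAnKe.bracket (fun i => (w i).eval)

/-- Replacing every letter `x` of a bracketed word by `σ x`. -/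
def Word.map (σ : Equiv.Perm X) : Word n X → Word n X
  | .letter x => .letter (σ x)
  | .bracket w => .bracket (fun i => (w i).map σ)

theorem Word.count_map [DecidableEq X] (σ : Equiv.Perm X) (x : X) (w : Word n X) :
    (w.map σ).count (σ x) = w.count x := by
  induction w with
  | letter y => simp [Word.map, Word.count]
  | bracket w ih => simp [Word.map, Word.count, ih]

theorem Word.eval_map (σ : Equiv.Perm X) (w : Word n X) :
    (w.map σ).eval = permRep n X σ w.eval := by
  induction w with
  | letter y => rfl
  | bracket w ih =>
    simp only [Word.map, Word.eval, ih]
    exact ((permHom n σ).map_bracket _).symm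

/-- The multilinear component of the free LAnKe on `X`: the span of the bracketed permutations,
that is, of the bracketed words containing each letter exactly once. -/
def multilinear (n : ℕ) (X : Type u) [DecidableEq X] : Subrepresentation (permRep n X) where
  toSubmodule := Submodule.span ℂ {a | ∃ w : Word n X, (∀ x, w.count x = 1) ∧ w.eval = a}
  apply_mem_toSubmodule σ v hv := by
    induction hv using Submodule.span_induction with
    | mem a ha =>
      obtain ⟨w, hw, rfl⟩ := ha
      refine Submodule.subset_span ⟨w.map σ, fun x => ?_, Word.eval_map σ w⟩
      have := Word.count_map σ (σ.symm x) w
      rw [Equiv.apply_symm_apply] at this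
      rw [this, hw]
    | zero => rw [map_zero]; exact Submodule.zero_mem _
    | add a b _ _ ha hb => rw [map_add]; exact Submodule.add_mem _ ha hb
    | smul c a _ ha => rw [map_smul]; exact Submodule.smul_mem _ c ha

end FreeLAnKe

/-- The representation of the symmetric group `S_m` on the multilinear component of the free
LAnKe (with `n`-ary bracket) on `m` generators. -/
def lieRep (n m : ℕ) :
    Representation ℂ (Equiv.Perm (Fin m)) (FreeLAnKe.multilinear n (Fin m)).toSubmodule :=
  (FreeLAnKe.multilinear n (Fin m)).toRepresentation

/-- A Young tableau of shape `μ`: a bijective filling of the cells by the elements of `Fin m`. -/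
abbrev YoungTableau (μ : YoungDiagram) (m : ℕ) := {c // c ∈ μ.cells} ≃ Fin m

namespace YoungTableau

variable {μ : YoungDiagram} {m : ℕ} (t : YoungTableau μ m)

/-- The row of the entry `x` in the tableau. -/
def row (x : Fin m) : ℕ := (t.symm x).1.1

/-- The column of the entry `x` in the tableau. -/
def col (x : Fin m) : ℕ := (t.symm x).1.2

/-- The row stabilizer of a tableau. -/
def rowStabilizer : Finset (Equiv.Perm (Fin m)) :=
  Finset.univ.filter fun σ => ∀ x, t.row (σ x) = t.row x

/-- The column stabilizer of a tableau. -/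
def colStabilizer : Finset (Equiv.Perm (Fin m)) :=
  Finset.univ.filter fun σ => ∀ x, t.col (σ x) = t.col x

/-- The Young symmetrizer `e_t = (∑_{α ∈ R_t} α) (∑_{β ∈ C_t} sgn(β) β)` in the group algebra. -/
def symmetrizer : MonoidAlgebra ℂ (Equiv.Perm (Fin m)) :=
  (∑ α ∈ t.rowStabilizer, MonoidAlgebra.single α 1) *
    ∑ β ∈ t.colStabilizer, MonoidAlgebra.single β ((Equiv.Perm.sign β : ℤ) : ℂ)

/-- The Specht module, as the submodule of the (left) regular representation spanned by the
elements `τ e_t`, `τ ∈ S_m`. -/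
def specht : Subrepresentation (Representation.leftRegular ℂ (Equiv.Perm (Fin m))) where
  toSubmodule := Submodule.span ℂ
    (Set.range fun τ : Equiv.Perm (Fin m) => MonoidAlgebra.single τ (1 : ℂ) * t.symmetrizer)
  apply_mem_toSubmodule σ v hv := by
    have key : ∀ a : MonoidAlgebra ℂ (Equiv.Perm (Fin m)),
        Representation.leftRegular ℂ (Equiv.Perm (Fin m)) σ a = MonoidAlgebra.single σ 1 * a := by
      intro a
      induction a using MonoidAlgebra.induction_linear with
      | zero => simp
      | add a b ha hb => rw [map_add, ha, hb, mul_add]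
      | single τ c => simp [MonoidAlgebra.single_mul_single]
    induction hv using Submodule.span_induction with
    | mem a ha =>
      obtain ⟨τ, rfl⟩ := ha
      refine Submodule.subset_span ⟨σ * τ, ?_⟩
      rw [key]
      simp only [← mul_assoc, MonoidAlgebra.single_mul_single, mul_one]
    | zero => rw [map_zero]; exact Submodule.zero_mem _
    | add a b _ _ ha hb => rw [map_add]; exact Submodule.add_mem _ ha hb
    | smul c a _ ha => rw [map_smul]; exact Submodule.smul_mem _ c ha

/-- The Specht module as a representation of the symmetric group. -/
def spechtRep :
    Representation ℂ (Equiv.Perm (Fin m)) t.specht.toSubmodule :=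
  t.specht.toRepresentation

end YoungTableau

/-- The Young diagram of shape `2^{n-1} 1`: `n - 1` rows of length `2` and one row of length
`1`. -/
def twoOneDiagram (n : ℕ) : YoungDiagram :=
  YoungDiagram.ofRowLens (List.replicate (n - 1) 2 ++ [1]) (by
    rw [List.sortedGE_iff_pairwise, List.pairwise_append]
    simp [List.pairwise_replicate])

theorem mem_twoOneDiagram (n i j : ℕ) :
    (i, j) ∈ (twoOneDiagram n).cells ↔ (i < n - 1 ∧ j < 2) ∨ (i = n - 1 ∧ j = 0) := by
  rw [YoungDiagram.mem_cells, twoOneDiagram, YoungDiagram.mem_ofRowLens]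
  simp only [List.length_append, List.length_replicate, List.length_singleton,
    List.getElem_append, List.getElem_replicate]
  constructor
  · rintro ⟨h, h'⟩
    split at h' <;> simp at h' <;> omega
  · rintro (⟨h, h'⟩ | ⟨h, h'⟩)
    · exact ⟨by omega, by simp [h, h']⟩
    · exact ⟨by omega, by simp [h, h']⟩

theorem card_twoOneDiagram (n : ℕ) (hn : 1 ≤ n) : (twoOneDiagram n).card = 2 * n - 1 := by
  have h : (twoOneDiagram n).cells = Finset.range n ×ˢ {0} ∪ Finset.range (n - 1) ×ˢ {1} := by
    ext ⟨i, j⟩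
    rw [mem_twoOneDiagram]
    simp only [Finset.mem_union, Finset.mem_product, Finset.mem_range, Finset.mem_singleton]
    omega
  rw [YoungDiagram.card, h, Finset.card_union_of_disjoint]
  · simp; omega
  · rw [Finset.disjoint_left]
    rintro ⟨i, j⟩ h1 h2
    simp at h1 h2
    omega

/-- There are tableaux of shape `2^{n-1} 1` filled with `Fin (2n-1)`. -/
theorem nonempty_tableau_twoOneDiagram (n : ℕ) (hn : 1 ≤ n) :
    Nonempty (YoungTableau (twoOneDiagram n) (2 * n - 1)) :=
  ⟨Fintype.equivFinOfCardEq (by rw [Fintype.card_coe]; exact card_twoOneDiagram n hn)⟩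

end

/-! Write `n = k + 1`. A word using `2k+1` letters once each is, up to sign, a double bracket
`[[x₀,…,x_k],y₁,…,y_k]`, and antisymmetry makes it depend, up to sign, only on the set `Y` of its
`k` outer letters. With signs normalised by `labelSign`, the Jacobi identity reads `v_Y = ε ∑_{x ∉
Y} v_{Yᶜ \ x}`, where `ε` is the same sign for every `Y`. A functional on the multilinear component
is therefore a function `f` on `k`-subsets with `f Y = ε (U f)(Yᶜ)`, where `U` is the up operator of
the Boolean lattice and `D` its adjoint, the down operator. On level `k` of a `(2k+1)`-set the
commutator `DU - UD` is the identity, so `‖f‖² = ‖U f‖² = ‖D f‖² + ‖f‖²` and `D f = 0`: the function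
`f` is harmonic.

The theorem follows from a cycle of inequalities of dimensions, multilinear component ≤ harmonic
functions ≤ Specht module ≤ multilinear component. The inequalities are `finrank_multilinear_le`
(the argument above), `finrank_harmonic_le_finrank_specht` and `spechtToLie_injective`. For the
second, a harmonic `g` gives the functional `σ ↦ sgn σ · g (σ (second column))`; its values on the
`τ e_t` are multiples of `k`-fold differences of `g` along disjoint pairs, and these determine `g`.
For the third, `y ↦ y · w` is equivariant, and substituting basis vectors of a LAnKe with bracket
`det(x₁,…,xₙ) v` recovers from `y · w` the pairings of `y` with all `τ e_t`, hence `y` itself.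
Equality throughout makes the third map an isomorphism. Since `D` is onto below the middle level,
the common dimension is `C(2k+1,k) - C(2k+1,k-1)`, a Catalan number. -/

noncomputable section

/-! ### Up and down operators; dimension of the space of harmonic functions. -/

namespace BooleanLattice

variable {α : Type*} [DecidableEq α]

/-- The up operator on functions on the Boolean lattice of finite subsets. -/
def up : (Finset α → ℂ) →ₗ[ℂ] (Finset α → ℂ) where
  toFun f X := ∑ x ∈ X, f (X.erase x)
  map_add' f g := by ext X; simp [Finset.sum_add_distrib]
  map_smul' c f := by ext X; simp [Finset.mul_sum]

/-- The down operator on functions on the Boolean lattice of finite subsets. -/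
def down [Fintype α] : (Finset α → ℂ) →ₗ[ℂ] (Finset α → ℂ) where
  toFun f Z := ∑ x ∈ Zᶜ, f (insert x Z)
  map_add' f g := by ext X; simp [Finset.sum_add_distrib]
  map_smul' c f := by ext X; simp [Finset.mul_sum]

theorem up_apply (f : Finset α → ℂ) (X : Finset α) : up f X = ∑ x ∈ X, f (X.erase x) := rfl

theorem down_apply [Fintype α] (f : Finset α → ℂ) (Z : Finset α) :
    down f Z = ∑ x ∈ Zᶜ, f (insert x Z) := rfl

theorem up_star (f : Finset α → ℂ) : up (star f) = star (up f) := by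
  ext X; simp [up_apply]

theorem down_star [Fintype α] (f : Finset α → ℂ) : down (star f) = star (down f) := by
  ext X; simp [down_apply]

theorem up_dotProduct [Fintype α] (f g : Finset α → ℂ) : up f ⬝ᵥ g = f ⬝ᵥ down g := by
  simp only [dotProduct, up_apply, down_apply, Finset.sum_mul, Finset.mul_sum]
  rw [Finset.sum_sigma', Finset.sum_sigma']
  refine Finset.sum_bij' (fun p _ => ⟨p.1.erase p.2, p.2⟩) (fun p _ => ⟨insert p.2 p.1, p.2⟩)
    ?_ ?_ ?_ ?_ ?_
  · rintro ⟨X, x⟩ h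
    simp
  · rintro ⟨X, x⟩ h
    simp
  · rintro ⟨X, x⟩ h
    simp only [Finset.mem_sigma, Finset.mem_univ, true_and] at h
    simp [Finset.insert_erase h]
  · rintro ⟨X, x⟩ h
    simp only [Finset.mem_sigma, Finset.mem_univ, true_and, Finset.mem_compl] at h
    simp [Finset.erase_insert h]
  · rintro ⟨X, x⟩ h
    simp only [Finset.mem_sigma, Finset.mem_univ, true_and] at h
    simp [Finset.insert_erase h]

/-- Adding `x ∉ Y` and removing `z ∈ Y` commute, so these terms agree on both sides. What remains is
adding and removing the same element, which gives `|Yᶜ|` copies of `f Y` in one order and `|Y|` in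
the other. -/
theorem down_up [Fintype α] (f : Finset α → ℂ) (Y : Finset α) :
    down (up f) Y = up (down f) Y + ((Fintype.card α : ℂ) - 2 * Y.card) * f Y := by
  have h1 : down (up f) Y = ∑ x ∈ Yᶜ, (f Y + ∑ z ∈ Y, f ((insert x Y).erase z)) := by
    rw [down_apply]
    refine Finset.sum_congr rfl fun x hx => ?_
    rw [Finset.mem_compl] at hx
    rw [up_apply, Finset.sum_insert hx, Finset.erase_insert hx]
  have h2 : up (down f) Y = ∑ z ∈ Y, (f Y + ∑ x ∈ Yᶜ, f ((insert x Y).erase z)) := by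
    rw [up_apply]
    refine Finset.sum_congr rfl fun z hz => ?_
    have hz' : z ∉ Yᶜ := by simpa using hz
    rw [down_apply, Finset.compl_erase, Finset.sum_insert hz', Finset.insert_erase hz]
    congr 1
    refine Finset.sum_congr rfl fun x hx => ?_
    rw [Finset.mem_compl] at hx
    rw [Finset.erase_insert_of_ne]
    rintro rfl
    exact hx hz
  have h3 : (Yᶜ.card : ℂ) = Fintype.card α - Y.card := by
    rw [Finset.card_compl, Nat.cast_sub (Finset.card_le_univ Y)]
  rw [h1, h2, Finset.sum_add_distrib, Finset.sum_add_distrib, Finset.sum_comm]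
  simp only [Finset.sum_const, nsmul_eq_mul, h3]
  ring

/-- The functions supported on the subsets with `k` elements. -/
def level (α : Type*) (k : ℕ) : Submodule ℂ (Finset α → ℂ) where
  carrier := {f | ∀ Y, Y.card ≠ k → f Y = 0}
  add_mem' hf hg Y hY := by simp [hf Y hY, hg Y hY]
  zero_mem' _ _ := rfl
  smul_mem' c f hf Y hY := by simp [hf Y hY]

theorem up_mem_level {k : ℕ} {f : Finset α → ℂ} (hf : f ∈ level α k) : up f ∈ level α (k + 1) := by
  intro X hX
  refine Finset.sum_eq_zero fun x hx => hf _ ?_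
  have := Finset.card_erase_add_one hx
  omega

theorem down_mem_level [Fintype α] {k : ℕ} {f : Finset α → ℂ} (hf : f ∈ level α (k + 1)) :
    down f ∈ level α k := by
  intro X hX
  refine Finset.sum_eq_zero fun x hx => hf _ ?_
  rw [Finset.card_insert_of_notMem (Finset.mem_compl.1 hx)]
  omega

/-- Restriction to the subsets with `k` elements. -/
def levelEquiv (α : Type*) [DecidableEq α] (k : ℕ) :
    level α k ≃ₗ[ℂ] ({Y : Finset α // Y.card = k} → ℂ) where
  toFun f Y := f.1 Y.1
  map_add' _ _ := rfl
  map_smul' _ _ := rfl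
  invFun f := ⟨fun Y => if h : Y.card = k then f ⟨Y, h⟩ else 0, fun Y hY => by simp [hY]⟩
  left_inv f := by
    ext Y
    by_cases h : Y.card = k
    · simp [h]
    · simp [h, f.2 Y h]
  right_inv f := by
    ext Y
    simp [Y.2]

theorem finrank_level [Fintype α] (k : ℕ) :
    Module.finrank ℂ (level α k) = (Fintype.card α).choose k := by
  rw [(levelEquiv α k).finrank_eq, Module.finrank_fintype_fun_eq_card, Fintype.card_finset_len]

/-- By adjointness `‖U f‖² = ⟨f, D U f⟩`, and the commutator is a scalar on level `k`. -/
theorem up_dotProduct_star_up [Fintype α] {k : ℕ} {f : Finset α → ℂ} (hf : f ∈ level α k) :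
    up f ⬝ᵥ star (up f) =
      down f ⬝ᵥ star (down f) + ((Fintype.card α : ℂ) - 2 * k) * (f ⬝ᵥ star f) := by
  have h : down (up (star f)) = up (down (star f)) +
      ((Fintype.card α : ℂ) - 2 * k) • star f := by
    ext Y
    rw [down_up]
    by_cases hY : Y.card = k
    · simp [hY]
    · simp [hf Y hY]
  rw [up_dotProduct, ← up_star, h, dotProduct_add, dotProduct_smul, dotProduct_comm,
    up_dotProduct, dotProduct_comm, down_star, smul_eq_mul]

theorem eq_zero_of_down_up_eq_zero [Fintype α] {k : ℕ} (hk : 2 * k < Fintype.card α) {f : Finset α → ℂ}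
    (hf : f ∈ level α k) (h : down (up f) = 0) : f = 0 := by
  open scoped ComplexOrder in
  have h1 : up f ⬝ᵥ star (up f) = 0 := by
    rw [← up_star, dotProduct_comm, up_dotProduct, h, dotProduct_zero]
  rw [up_dotProduct_star_up hf] at h1
  have h2 : (0 : ℂ) < (Fintype.card α : ℂ) - 2 * k := by
    rw [sub_pos]
    exact_mod_cast hk
  -- Below the middle level the scalar is positive, so a zero sum of two nonnegative terms forces
  -- `‖f‖² = 0`.
  have h3 := (add_eq_zero_iff_of_nonneg (dotProduct_self_star_nonneg (down f))
    (mul_nonneg h2.le (dotProduct_self_star_nonneg f))).1 h1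
  rcases mul_eq_zero.1 h3.2 with h4 | h4
  · exact absurd h4 h2.ne'
  · exact dotProduct_self_star_eq_zero.1 h4

/-- If `f` is supported on the `k`-subsets of a set with `2 k + 1` elements and, up to a sign,
invariant under the operator summing over disjoint `k`-subsets, then `f` is killed by the
down operator. -/
theorem down_eq_zero_of_disjoint_sum [Fintype α] {k : ℕ} (hα : Fintype.card α = 2 * k + 1)
    {f : Finset α → ℂ} (hf : f ∈ level α k) {ε : ℂ} (hε : ε * star ε = 1)
    (h : ∀ Y : Finset α, Y.card = k → f Y = ε * up f Yᶜ) : down f = 0 := by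
  have h' : ∀ Y, f Y = ε * up f Yᶜ := by
    intro Y
    by_cases hY : Y.card = k
    · exact h Y hY
    · rw [hf Y hY, up_mem_level hf, mul_zero]
      rw [Finset.card_compl]
      have := Finset.card_le_univ Y
      omega
  -- Complementation permutes the subsets and `|ε| = 1`, so `f` and `up f` have equal norm. As `card
  -- α - 2k = 1`, the norm identity then leaves only `‖down f‖² = 0`.
  have h1 : f ⬝ᵥ star f = up f ⬝ᵥ star (up f) := by
    simp only [dotProduct, Pi.star_apply]
    rw [← Equiv.sum_comp (Equiv.ofBijective _ (compl_bijective (α := Finset α)))]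
    refine Finset.sum_congr rfl fun Y _ => ?_
    rw [h' (Equiv.ofBijective _ _ Y)]
    simp only [Equiv.ofBijective_apply, compl_compl, star_mul']
    linear_combination (up f Y * star (up f Y)) * hε
  rw [up_dotProduct_star_up hf, hα] at h1
  push_cast at h1
  open scoped ComplexOrder in
  exact dotProduct_self_star_eq_zero.1 (by linear_combination -h1)

/-- The functions supported on the subsets with `k` elements and killed by the down operator. -/
def harmonic (α : Type*) [Fintype α] [DecidableEq α] (k : ℕ) : Submodule ℂ (Finset α → ℂ) :=
  level α k ⊓ LinearMap.ker down

/-- `down ∘ up` is an injective endomorphism of the finite-dimensional level `k`, hence surjective;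
so `down` maps level `k + 1` onto level `k`, with kernel the harmonic functions. -/
theorem finrank_harmonic_add [Fintype α] {k : ℕ} (hk : 2 * k < Fintype.card α) :
    Module.finrank ℂ (harmonic α (k + 1)) + (Fintype.card α).choose k =
      (Fintype.card α).choose (k + 1) := by
  let D : level α (k + 1) →ₗ[ℂ] level α k :=
    down.restrict fun _ => down_mem_level
  let U : level α k →ₗ[ℂ] level α (k + 1) := up.restrict fun _ => up_mem_level
  have hinj : Function.Injective (D ∘ₗ U) := by
    rw [← LinearMap.ker_eq_bot, LinearMap.ker_eq_bot']
    intro f hf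
    exact Subtype.ext (eq_zero_of_down_up_eq_zero hk f.2 (congrArg Subtype.val hf))
  have hsurj : Function.Surjective D :=
    Function.Surjective.of_comp (g := U) (LinearMap.injective_iff_surjective.1 hinj)
  have hker : LinearMap.ker D = Submodule.comap (level α (k + 1)).subtype (LinearMap.ker down) := by
    ext f
    simp [D, Subtype.ext_iff]
  have h := LinearMap.finrank_range_add_finrank_ker D
  rw [LinearMap.range_eq_top.2 hsurj, finrank_top, finrank_level, finrank_level, hker] at h
  have e := (Submodule.comapSubtypeEquivOfLe (p := level α (k + 1) ⊓ LinearMap.ker down)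
    (q := level α (k + 1)) inf_le_left).finrank_eq
  rw [Submodule.comap_inf, Submodule.comap_subtype_self, top_inf_eq] at e
  rw [harmonic, ← e]
  omega

theorem finrank_harmonic [Fintype α] {k : ℕ} (hα : Fintype.card α = 2 * (k + 1) + 1) :
    (Module.finrank ℂ (harmonic α (k + 1)) : ℚ) =
      1 / (((k + 2 : ℕ) : ℚ) + 1) * ((2 * (k + 2)).choose (k + 2) : ℚ) := by
  have h := finrank_harmonic_add (α := α) (k := k) (by omega)
  rw [hα] at h
  -- With `N = 2k+3`: `(k+1) C(N,k+1) = (k+3) C(N,k)`, while Pascal and symmetry give `C(N+1,k+2) =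
  -- 2 C(N,k+1)`.
  have h1 := Nat.choose_succ_right_eq (2 * (k + 1) + 1) k
  have h2 := Nat.choose_succ_succ (2 * (k + 1) + 1) (k + 1)
  have h3 : (2 * (k + 1) + 1).choose (k + 1 + 1) = (2 * (k + 1) + 1).choose (k + 1) :=
    Nat.choose_symm_of_eq_add (by ring)
  have h4 : 2 * (k + 2) = (2 * (k + 1) + 1).succ := by omega
  rw [show 2 * (k + 1) + 1 - k = k + 3 by omega] at h1
  rw [h4, show k + 2 = (k + 1).succ from rfl, h2, Nat.succ_eq_add_one, h3]
  qify at h h1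
  have h5 : ((k : ℚ) + 3) ≠ 0 := by positivity
  push_cast
  rw [one_div, inv_mul_eq_div, eq_div_iff (by convert h5 using 1; ring)]
  linear_combination (k + 3 : ℚ) * h + h1

end BooleanLattice

/-! ### Iterated differences detect harmonic functions. -/

namespace BooleanLattice

variable {α : Type*}

/-- The iterated difference of `g` along a list of pairs, evaluated at `Z`. -/
def altSum [DecidableEq α] (g : Finset α → ℂ) : List (α × α) → Finset α → ℂ
  | [], Z => g Z
  | p :: l, Z => altSum g l (insert p.1 Z) - altSum g l (insert p.2 Z)

/-- The list of all entries of a list of pairs. -/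
def entries (l : List (α × α)) : List α := l.flatMap fun p => [p.1, p.2]

theorem entries_cons (p : α × α) (l : List (α × α)) :
    entries (p :: l) = p.1 :: p.2 :: entries l := rfl

/-- Differences inherit the equation `down g = 0`: the terms in which `z` is the other member of a
pair cancel, because `{p, q}` arises once with each sign. -/
theorem sum_altSum_insert [Fintype α] [DecidableEq α] {g : Finset α → ℂ} (hg : down g = 0) (l : List (α × α))
    (hl : (entries l).Nodup) (Z : Finset α) (hZ : ∀ x ∈ entries l, x ∉ Z) :
    ∑ z ∈ (Z ∪ (entries l).toFinset)ᶜ, altSum g l (insert z Z) = 0 := by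
  induction l generalizing Z with
  | nil => simpa [entries, altSum, down_apply] using congrFun hg Z
  | cons p l ih =>
    obtain ⟨p, q⟩ := p
    rw [entries_cons] at hl hZ
    simp only [List.nodup_cons, List.mem_cons, not_or] at hl
    obtain ⟨⟨hpq, hpl⟩, hql, hl⟩ := hl
    simp only [List.mem_cons, forall_eq_or_imp] at hZ
    obtain ⟨hpZ, hqZ, hZ⟩ := hZ
    -- The induction hypothesis for `insert u Z` sums over one point more, namely `v`. The resulting
    -- expression is symmetric in `u` and `v`, so the two halves of the difference cancel.
    have aux : ∀ u v : α, u ≠ v → v ∉ entries l → v ∉ Z → u ∉ entries l →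
        (∀ A : Finset α, A = (Z ∪ (u :: v :: entries l).toFinset)ᶜ →
        ∑ z ∈ A, altSum g l (insert u (insert z Z)) = -altSum g l (insert u (insert v Z))) := by
      intro u v huv hvl hvZ hul A hA
      have h := ih hl (insert u Z) (by
        intro x hx
        rw [Finset.mem_insert, not_or]
        exact ⟨fun hxu => hul (hxu ▸ hx), hZ x hx⟩)
      have hS : (insert u Z ∪ (entries l).toFinset)ᶜ = insert v A := by
        ext z
        simp only [hA, Finset.mem_compl, Finset.mem_union, Finset.mem_insert, List.mem_toFinset,
          List.mem_cons]
        by_cases hzv : z = v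
        · subst hzv
          simp [hvl, hvZ, huv.symm]
        · simp [hzv]
          tauto
      rw [hS, Finset.sum_insert (by simp [hA])] at h
      simp only [Finset.insert_comm _ u] at h
      exact eq_neg_of_add_eq_zero_right h
    simp only [altSum, Finset.sum_sub_distrib, entries_cons]
    rw [aux p q hpq hql hqZ hpl _ rfl, aux q p (Ne.symm hpq) hpl hpZ hql _
      (by simp [Finset.insert_comm]), Finset.insert_comm]
    ring

/-- Trading pairs for points of `Z`: vanishing of the difference with one more pair `(z, p)` says
that the value at `insert z Z` does not depend on `z`. These equal values sum to zero over a
nonempty set, so each is zero. For `l = []` the conclusion is `g Z = 0`. -/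
theorem altSum_eq_zero [Fintype α] [DecidableEq α] {g : Finset α → ℂ} (hg : down g = 0) {k : ℕ}
    (h : ∀ l : List (α × α), l.length = k → (entries l).Nodup → altSum g l ∅ = 0)
    (d : ℕ) (l : List (α × α)) (hk : l.length + d = k) (hl : (entries l).Nodup) (Z : Finset α)
    (hd : Z.card = d) (hZ : ∀ x ∈ entries l, x ∉ Z) : altSum g l Z = 0 := by
  induction d generalizing l Z with
  | zero =>
    rw [Finset.card_eq_zero.1 hd]
    exact h l hk hl
  | succ d ih =>
    obtain ⟨p, Z, hp, rfl, hc⟩ := Finset.card_eq_succ.1 hd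
    have hZ' : ∀ x ∈ entries l, x ∉ Z := fun x hx hxZ => hZ x hx (Finset.mem_insert_of_mem hxZ)
    have hpl : p ∉ entries l := fun hpl => hZ p hpl (Finset.mem_insert_self _ _)
    have hconst : ∀ z ∈ (Z ∪ (entries l).toFinset)ᶜ,
        altSum g l (insert z Z) = altSum g l (insert p Z) := by
      intro z hz
      simp only [Finset.mem_compl, Finset.mem_union, List.mem_toFinset, not_or] at hz
      by_cases hzp : z = p
      · rw [hzp]
      · have := ih ((z, p) :: l) (by simp only [List.length_cons]; omega)
          (by
            rw [entries_cons, List.nodup_cons, List.nodup_cons, List.mem_cons, not_or]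
            exact ⟨⟨hzp, hz.2⟩, hpl, hl⟩) Z hc
          (by
            intro x hx
            rw [entries_cons, List.mem_cons, List.mem_cons] at hx
            rcases hx with rfl | rfl | hx
            exacts [hz.1, hp, hZ' x hx])
        exact sub_eq_zero.1 this
    have hs := sum_altSum_insert hg l hl Z hZ'
    rw [Finset.sum_congr rfl hconst, Finset.sum_const, smul_eq_zero] at hs
    rcases hs with hs | hs
    · rw [Finset.card_eq_zero] at hs
      have : p ∈ (Z ∪ (entries l).toFinset)ᶜ := by simp [hp, hpl]
      rw [hs] at this
      simp at this
    · exact hs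

/-- A harmonic function of degree `k` is zero if all its `k`-fold iterated differences along
disjoint pairs vanish. -/
theorem eq_zero_of_altSum_eq_zero [Fintype α] [DecidableEq α] {k : ℕ} {g : Finset α → ℂ} (hg : g ∈ harmonic α k)
    (h : ∀ l : List (α × α), l.length = k → (entries l).Nodup → altSum g l ∅ = 0) : g = 0 := by
  ext Z
  by_cases hZ : Z.card = k
  · exact altSum_eq_zero hg.2 h k [] (by simp) (by simp [entries]) Z hZ (by simp [entries])
  · exact hg.1 Z hZ

/-- Choosing a member of each pair is choosing a permutation of `Bool` for each row, and the sign of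
the choice is the sign of the permutation. This is the form that matches a row stabilizer. -/
theorem altSum_ofFn [DecidableEq α] (g : Finset α → ℂ) {j : ℕ} (f : Fin j × Bool → α) (Z : Finset α) :
    altSum g (List.ofFn fun i => (f (i, true), f (i, false))) Z =
      ∑ s : Fin j → Equiv.Perm Bool, ((∏ i, Equiv.Perm.sign (s i) : ℤˣ) : ℤ) *
        g (Z ∪ Finset.univ.image fun i => f (i, s i true)) := by
  induction j generalizing Z with
  | zero => simp [altSum]
  | succ j ih =>
    rw [List.ofFn_succ, altSum, ih (fun x => f (x.1.succ, x.2)), ih (fun x => f (x.1.succ, x.2)),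
      ← (Fin.consEquiv fun _ => Equiv.Perm Bool).sum_comp, Fintype.sum_prod_type]
    have hperm : (Finset.univ : Finset (Equiv.Perm Bool)) = {1, Equiv.swap true false} := by decide
    have himg : ∀ (π : Equiv.Perm Bool) (s : Fin j → Equiv.Perm Bool),
        (Z ∪ Finset.univ.image fun i => f (i, (Fin.cons π s : Fin (j + 1) → _) i true)) =
        insert (f (0, π true)) Z ∪ Finset.univ.image fun i => f (i.succ, s i true) := by
      intro π s
      ext x
      simp [Fin.exists_fin_succ, or_left_comm, eq_comm]
    simp only [Fin.consEquiv_apply, himg, Fin.prod_univ_succ, Fin.cons_zero, Fin.cons_succ]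
    rw [hperm, Finset.sum_pair (by decide)]
    simp [sub_eq_add_neg]

/-- The cells of the shape `2^k 1`: `k` rows of length two and a single additional cell. -/
abbrev Cell (k : ℕ) : Type := Option (Fin k × Bool)

theorem exists_optionCongr_prodCongrRight {k : ℕ} (π : Equiv.Perm (Cell k))
    (h : ∀ b, (π b).map Prod.fst = b.map Prod.fst) :
    ∃ s : Fin k → Equiv.Perm Bool, Equiv.optionCongr (Equiv.prodCongrRight s) = π := by
  have h0 : π none = none := by simpa using h none
  have h1 : ∀ i b, ∃ b', π (some (i, b)) = some (i, b') := by
    intro i b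
    have := h (some (i, b))
    simp only [Option.map_some, Option.map_eq_some_iff, Prod.exists] at this
    obtain ⟨i', b', h', rfl⟩ := this
    exact ⟨b', h'⟩
  choose f hf using h1
  have hinj : ∀ i, Function.Injective (f i) := by
    intro i b b' hb
    have : π (some (i, b)) = π (some (i, b')) := by rw [hf, hf, hb]
    simpa using this
  refine ⟨fun i => Equiv.ofBijective (f i) (Finite.injective_iff_bijective.1 (hinj i)), ?_⟩
  ext1 b
  rcases b with _ | ⟨i, b⟩
  · simp [h0]
  · simp [hf]

/-- If the signed sums of a harmonic function over the row stabilizer of a tableau of shape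
`2^k 1` vanish, then the function is zero. -/
theorem eq_zero_of_sum_rowStabilizer_eq_zero [Fintype α] [DecidableEq α] {k : ℕ} {ι : Type*} [DecidableEq ι]
    (e : Cell k ≃ α) (row : α → ι)
    (hrow : ∀ b b', row (e b) = row (e b') ↔ b.map Prod.fst = b'.map Prod.fst)
    {g : Finset α → ℂ} (hg : g ∈ harmonic α k)
    (h : ∀ τ : Equiv.Perm α,
      ∑ a ∈ Finset.univ.filter (fun a : Equiv.Perm α => ∀ x, row (a x) = row x),
        ((Equiv.Perm.sign a : ℤ) : ℂ) *
          g (Finset.univ.image fun i : Fin k => τ (a (e (some (i, true))))) = 0) : g = 0 := by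
  refine eq_zero_of_altSum_eq_zero hg fun l hlen hl => ?_
  obtain ⟨f, hf, rfl⟩ : ∃ f : Fin k × Bool → α, Function.Injective f ∧
      l = List.ofFn fun i => (f (i, true), f (i, false)) := by
    subst hlen
    refine ⟨fun x => if x.2 then (l.get x.1).1 else (l.get x.1).2, ?_, by simp⟩
    have hl' := List.nodup_flatMap.1 hl
    have hne : ∀ i, (l.get i).1 ≠ (l.get i).2 := by
      intro i
      have := hl'.1 (l.get i) (List.get_mem l i)
      simpa using this
    have hlt : ∀ i j : Fin l.length, i < j →
        List.Disjoint [(l.get i).1, (l.get i).2] [(l.get j).1, (l.get j).2] :=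
      fun i j hij => List.pairwise_iff_get.1 hl'.2 i j hij
    have hmem : ∀ (i : Fin l.length) (b : Bool),
        (if b then (l.get i).1 else (l.get i).2) ∈ [(l.get i).1, (l.get i).2] := by
      rintro i (_ | _) <;> simp
    rintro ⟨i, b⟩ ⟨j, c⟩ hij
    dsimp only at hij
    rcases lt_trichotomy i j with hij' | rfl | hij'
    · exact (hlt i j hij' (hmem i b) (hij ▸ hmem j c)).elim
    · have h1 := hne i
      have h2 := h1.symm
      cases b <;> cases c <;> first | rfl | exact absurd hij (by simpa using h1) |
        exact absurd hij (by simpa using h2)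
    · exact (hlt j i hij' (hmem j c) (hij ▸ hmem i b)).elim
  -- A permutation carrying the two-cell rows of the tableau to the given pairs exists because both
  -- families are injective; for this `τ` the signed row sum is the given difference.
  obtain ⟨τ, hτ⟩ := Equiv.Perm.exists_extending_pair (fun x => e (some x)) f
    (e.injective.comp (Option.some_injective _)) hf
  rw [altSum_ofFn, ← h τ]
  refine Finset.sum_bij (fun s _ => e.permCongr (Equiv.optionCongr (Equiv.prodCongrRight s)))
    ?_ ?_ ?_ ?_
  · intro s _
    simp only [Finset.mem_filter, Finset.mem_univ, true_and]
    intro x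
    obtain ⟨b, rfl⟩ := e.surjective x
    rw [Equiv.permCongr_apply, Equiv.symm_apply_apply, hrow]
    rcases b with _ | ⟨i, b⟩ <;> simp
  · intro s _ s' _ hs
    have hs := e.permCongr.injective hs
    ext i b
    have := congrArg (fun π => π (some (i, b))) hs
    simpa using this
  · intro a ha
    simp only [Finset.mem_filter, Finset.mem_univ, true_and] at ha
    obtain ⟨s, hs⟩ := exists_optionCongr_prodCongrRight (e.symm.permCongr a) (by
      intro b
      rw [← hrow, Equiv.permCongr_apply, Equiv.apply_symm_apply, Equiv.symm_symm, ha])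
    refine ⟨s, Finset.mem_univ _, ?_⟩
    rw [hs]
    ext x
    simp [Equiv.permCongr_apply]
  · intro s _
    simp [Equiv.permCongr_apply, Equiv.Perm.sign_permCongr, Equiv.Perm.sign_prodCongrRight, ← hτ]

end BooleanLattice

/-! ### Symmetries of the double bracket. -/

/-- The bracket `[[x₀,…,x_k],y₁,…,y_k]` in a LAnKe with `(k+1)`-ary bracket. -/
def LAnKe.pairBracket {k : ℕ} {L : Type*} [AddCommGroup L] [Module ℂ L] [LAnKe (k + 1) L]
    (x : Fin (k + 1) → L) (y : Fin k → L) : L :=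
  LAnKe.bracket (Fin.cons (LAnKe.bracket x) y : Fin (k + 1) → L)

namespace LAnKe

variable {k : ℕ} {L : Type*} [AddCommGroup L] [Module ℂ L] [LAnKe (k + 1) L]

theorem pairBracket_perm (σ : Equiv.Perm (Fin (k + 1))) (π : Equiv.Perm (Fin k))
    (x : Fin (k + 1) → L) (y : Fin k → L) :
    pairBracket x y =
      (Equiv.Perm.sign σ * Equiv.Perm.sign π) • pairBracket (x ∘ σ) (y ∘ π) := by
  -- `decomposeFin.symm (0, π)` fixes `0` and acts as `π` on successors, so it permutes the outer
  -- letters with sign `sign π`.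
  rw [pairBracket, antisymm (Equiv.Perm.decomposeFin.symm (0, π)), antisymm σ x,
    Equiv.Perm.decomposeFin.symm_sign, if_pos rfl, one_mul]
  have h : ∀ a : L, (fun i => (Fin.cons a y : Fin (k + 1) → L)
      (Equiv.Perm.decomposeFin.symm (0, π) i)) = Fin.cons a (y ∘ π) := by
    intro a
    funext i
    refine Fin.cases ?_ (fun j => ?_) i
    · simp
    · simp
  rw [h, mul_comm, mul_smul]
  congr 1
  have := (bracket (n := k + 1) (L := L)).map_update_smul (Fin.cons 0 (y ∘ π)) 0
    ((Equiv.Perm.sign σ : ℤ) : ℂ) (bracket (x ∘ σ))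
  simpa [Fin.update_cons_zero, Units.smul_def, Int.cast_smul_eq_zsmul, pairBracket,
    Function.comp_def] using this

/-- In the `i`-th term of the Jacobi identity the compound entry sits in slot `i`; swapping `0` and
`i` brings it to the front. -/
theorem pairBracket_jacobi (x : Fin (k + 1) → L) (y : Fin k → L) :
    pairBracket x y = ∑ i, Equiv.Perm.sign (Equiv.swap 0 i) •
      pairBracket (Fin.cons (x i) y : Fin (k + 1) → L)
        (fun j => x (Equiv.swap 0 i j.succ)) := by
  have h := jacobi (L := L) (Nat.succ_pos k) x (Fin.cons 0 y)
  have h0 : (⟨0, Nat.succ_pos k⟩ : Fin (k + 1)) = 0 := rfl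
  simp only [h0, Fin.update_cons_zero] at h
  rw [pairBracket, h]
  refine Finset.sum_congr rfl fun i _ => ?_
  rw [antisymm (Equiv.swap 0 i), pairBracket]
  congr 2
  funext j
  refine Fin.cases ?_ (fun j => ?_) j
  · simp
  · rw [Fin.cons_succ, Function.update_of_ne]
    intro h
    rw [Equiv.swap_apply_eq_iff, Equiv.swap_apply_right] at h
    exact Fin.succ_ne_zero j h

theorem _root_.LAnKeHom.map_pairBracket {K : Type*} [AddCommGroup K] [Module ℂ K]
    [LAnKe (k + 1) K] (F : LAnKeHom (k + 1) L K) (x : Fin (k + 1) → L) (y : Fin k → L) :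
    F.toLinearMap (pairBracket x y) =
      pairBracket (F.toLinearMap ∘ x) (F.toLinearMap ∘ y) := by
  rw [pairBracket, F.map_bracket, pairBracket]
  congr 1
  funext i
  refine Fin.cases ?_ (fun j => ?_) i
  · simp [F.map_bracket, Function.comp_def]
  · simp

end LAnKe

namespace FreeLAnKe

open LAnKe (pairBracket pairBracket_perm pairBracket_jacobi)

variable {k : ℕ} {α : Type*}

/-- The bracketed word `[[e₀,…,e_k],e'₁,…,e'_k]` of a labelling `e` by letters. -/
def pairWord (e : Fin (k + 1) ⊕ Fin k → α) : FreeLAnKe (k + 1) α :=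
  pairBracket (fun i => of (k + 1) (e (Sum.inl i))) (fun j => of (k + 1) (e (Sum.inr j)))

theorem permRep_pairWord (σ : Equiv.Perm α) (e : Fin (k + 1) ⊕ Fin k → α) :
    permRep (k + 1) α σ (pairWord e) = pairWord (σ ∘ e) :=
  (permHom (k + 1) σ).map_pairBracket _ _

theorem pairWord_sumCongr (σ : Equiv.Perm (Fin (k + 1))) (π : Equiv.Perm (Fin k))
    (e : Fin (k + 1) ⊕ Fin k → α) :
    pairWord e = Equiv.Perm.sign (Equiv.sumCongr σ π) • pairWord (e ∘ Equiv.sumCongr σ π) := by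
  rw [Equiv.Perm.sign_sumCongr, pairWord, pairBracket_perm σ π]
  rfl

/-- The permutation exchanging the last `k` positions of the inner bracket of `pairWord` with the
last `k` positions of the outer bracket. -/
def exchange (k : ℕ) : Equiv.Perm (Fin (k + 1) ⊕ Fin k) :=
  Function.Involutive.toPerm
    (Sum.elim (fun i => Fin.cases (motive := fun _ => Fin (k + 1) ⊕ Fin k) (Sum.inl 0) Sum.inr i)
      fun j => Sum.inl j.succ)
    (by
      rintro (i | j)
      · refine Fin.cases ?_ (fun i => ?_) i <;> simp
      · simp)

theorem exchange_inl_zero : exchange k (Sum.inl 0) = Sum.inl 0 := rfl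

theorem exchange_inl_succ (i : Fin k) : exchange k (Sum.inl i.succ) = Sum.inr i := rfl

theorem exchange_inr (i : Fin k) : exchange k (Sum.inr i) = Sum.inl i.succ := rfl

/-- Each term is a relabelling by a permutation of positions, so its sign can be compared with
`labelSign`. -/
theorem pairWord_jacobi (e : Fin (k + 1) ⊕ Fin k → α) :
    pairWord e = ∑ i, Equiv.Perm.sign (Equiv.swap 0 i) •
      pairWord (e ∘ Equiv.sumCongr (Equiv.swap 0 i) (Equiv.refl _) ∘ exchange k) := by
  rw [pairWord, pairBracket_jacobi]
  refine Finset.sum_congr rfl fun i _ => ?_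
  congr 1
  rw [pairWord]
  congr 1
  funext j
  refine Fin.cases ?_ (fun j => ?_) j
  · simp [exchange_inl_zero]
  · simp only [Fin.cons_succ, Function.comp_apply, exchange_inl_succ]
    rfl

/-! ### Double brackets span the multilinear component. -/

/-- The number of letters of a bracketed word. -/
def Word.size {n : ℕ} {X : Type*} : Word n X → ℕ
  | .letter _ => 1
  | .bracket w => ∑ i, (w i).size

namespace Word

theorem sum_count {n : ℕ} [Fintype α] [DecidableEq α] (w : Word n α) :
    ∑ x, w.count x = w.size := by
  induction w with
  | letter y => simp [count, size]
  | bracket w ih =>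
    simp only [count, size]
    rw [Finset.sum_comm]
    exact Finset.sum_congr rfl fun i _ => ih i

theorem one_le_size (w : Word (k + 1) α) : 1 ≤ w.size := by
  induction w with
  | letter y => exact le_rfl
  | bracket w ih => exact (ih 0).trans (Finset.single_le_sum (f := fun i => (w i).size)
      (fun _ _ => Nat.zero_le _) (Finset.mem_univ 0))

theorem le_size_bracket (w : Fin (k + 1) → Word (k + 1) α) : k + 1 ≤ (bracket w).size := by
  have := Finset.card_nsmul_le_sum Finset.univ (fun i => (w i).size) 1
    (fun i _ => one_le_size (w i))
  simpa [size] using this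

theorem exists_eq_letter (hk : 1 ≤ k) {w : Word (k + 1) α} (hw : w.size = 1) :
    ∃ x, w = letter x := by
  rcases w with x | w
  · exact ⟨x, rfl⟩
  · have := le_size_bracket w
    omega

theorem exists_eq_letters (hk : 1 ≤ k) {ι : Type*} (s : Finset ι) (w : ι → Word (k + 1) α)
    (hw : ∑ i ∈ s, (w i).size = s.card) : ∀ i ∈ s, ∃ x, w i = letter x := by
  have h : ∑ i ∈ s, 1 = ∑ i ∈ s, (w i).size := by rw [hw]; simp
  exact fun i hi => exists_eq_letter hk
    ((Finset.sum_eq_sum_iff_of_le fun i _ => one_le_size (w i)).1 h i hi).symm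

/-- An inner bracket has at least `k + 1` letters and the other `k` slots at least one each, which
already uses all `2k+1`; so everything else is a letter. For `k = 0` unary brackets could be nested
without changing the size. -/
theorem exists_eq_bracket_bracket (hk : 1 ≤ k) {w : Word (k + 1) α} (hw : w.size = 2 * k + 1) :
    ∃ (i : Fin (k + 1)) (x y : Fin (k + 1) → α),
      w = bracket (Function.update (fun j => letter (y j)) i (bracket fun j => letter (x j))) := by
  rcases w with x | f
  · simp only [size] at hw
    omega
  obtain ⟨i, g, hg⟩ : ∃ i g, f i = bracket g := by
    by_contra! h
    have h1 : ∀ i, (f i).size = 1 := by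
      intro i
      cases hf : f i with
      | letter x => rfl
      | bracket g => exact absurd hf (h i g)
    simp only [size, h1, Finset.sum_const, Finset.card_univ, Fintype.card_fin, smul_eq_mul] at hw
    omega
  have h1 := le_size_bracket g
  have h2 := Finset.card_nsmul_le_sum (Finset.univ.erase i) (fun i => (f i).size) 1
    (fun i _ => one_le_size (f i))
  have hcard : (Finset.univ.erase i).card = k := by simp
  rw [hcard, smul_eq_mul, mul_one] at h2
  rw [size, ← Finset.add_sum_erase _ _ (Finset.mem_univ i), hg] at hw
  have h3 := exists_eq_letters hk (Finset.univ.erase i) f (by omega)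
  have h4 := exists_eq_letters hk Finset.univ g (by
    have : (bracket g).size = k + 1 := by omega
    simpa [size] using this)
  have : ∀ j, ∃ x, j ≠ i → f j = letter x := by
    intro j
    by_cases hj : j = i
    · obtain ⟨x, -⟩ := h4 0 (Finset.mem_univ _)
      exact ⟨x, fun h => absurd hj h⟩
    · obtain ⟨x, hx⟩ := h3 j (by simp [hj])
      exact ⟨x, fun _ => hx⟩
  choose y hy using this
  choose x hx using h4
  refine ⟨i, fun j => x j (Finset.mem_univ j), y, ?_⟩
  congr 1
  funext j
  by_cases hj : j = i
  · subst hj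
    rw [Function.update_self, hg]
    congr 1
    funext j
    exact hx j _
  · rw [Function.update_of_ne hj, hy j hj]

end Word

theorem pairWord_mem_multilinear [Fintype α] [DecidableEq α] (e : Fin (k + 1) ⊕ Fin k ≃ α) :
    pairWord e ∈ (multilinear (k + 1) α).toSubmodule := by
  refine Submodule.subset_span ⟨.bracket (Fin.cons (.bracket fun i => .letter (e (Sum.inl i)))
    fun j => .letter (e (Sum.inr j))), fun x => ?_, ?_⟩
  · obtain ⟨b, rfl⟩ := e.surjective x
    simp only [Word.count, Fin.sum_univ_succ (n := k), Fin.cons_zero, Fin.cons_succ,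
      EmbeddingLike.apply_eq_iff_eq]
    rcases b with b | b
    · rw [← Fin.sum_univ_succ (fun i => if (Sum.inl i : Fin (k + 1) ⊕ Fin k) = Sum.inl b
        then 1 else 0)]
      simp
    · simp
  · rw [Word.eval, pairWord, pairBracket]
    congr 1
    funext i
    refine Fin.cases ?_ (fun j => ?_) i <;> simp [Word.eval]

theorem multilinear_eq_span_pairWord [Fintype α] [DecidableEq α] (hk : 1 ≤ k)
    (hα : Fintype.card α = 2 * k + 1) :
    (multilinear (k + 1) α).toSubmodule =
      Submodule.span ℂ (Set.range fun e : Fin (k + 1) ⊕ Fin k ≃ α => pairWord e) := by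
  refine le_antisymm (Submodule.span_le.2 ?_) (Submodule.span_le.2 ?_)
  · rintro _ ⟨w, hw, rfl⟩
    have hsize : w.size = 2 * k + 1 := by
      rw [← Word.sum_count]
      simp [hw, hα]
    obtain ⟨i, x, y, rfl⟩ := Word.exists_eq_bracket_bracket hk hsize
    -- Every letter occurs, and the number of positions equals the number of letters, so
    -- surjectivity suffices for a bijection.
    have hsurj : Function.Surjective
        (Sum.elim x fun j : Fin k => y (Equiv.swap 0 i j.succ)) := by
      intro z
      have hz := hw z
      simp only [Word.count] at hz
      obtain ⟨j, -, hj⟩ := Finset.exists_ne_zero_of_sum_ne_zero (hz.trans_ne one_ne_zero)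
      by_cases hji : j = i
      · subst hji
        rw [Function.update_self, Word.count] at hj
        obtain ⟨l, -, hl⟩ := Finset.exists_ne_zero_of_sum_ne_zero hj
        simp only [Word.count, ne_eq, ite_eq_right_iff, one_ne_zero, imp_false, not_not] at hl
        exact ⟨Sum.inl l, hl⟩
      · rw [Function.update_of_ne hji] at hj
        simp only [Word.count, ne_eq, ite_eq_right_iff, one_ne_zero, imp_false, not_not] at hj
        have h0 : Equiv.swap 0 i j ≠ 0 := by
          intro h
          rw [Equiv.swap_apply_eq_iff, Equiv.swap_apply_left] at h
          exact hji h
        obtain ⟨l, hl⟩ := Fin.exists_succ_eq.2 h0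
        refine ⟨Sum.inr l, ?_⟩
        rw [Sum.elim_inr, hl, Equiv.swap_apply_self, hj]
    have hbij := (Fintype.bijective_iff_surjective_and_card _).2 ⟨hsurj, by
      rw [hα, Fintype.card_sum, Fintype.card_fin, Fintype.card_fin]; omega⟩
    have heval : Word.eval (Word.bracket (Function.update (fun j => Word.letter (y j)) i
          (Word.bracket fun j => Word.letter (x j)))) =
        Equiv.Perm.sign (Equiv.swap 0 i) • pairWord (k := k) (Equiv.ofBijective _ hbij) := by
      rw [Word.eval, LAnKe.antisymm (Equiv.swap 0 i), pairWord, pairBracket]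
      congr 2
      funext j
      refine Fin.cases ?_ (fun j => ?_) j
      · simp [Word.eval]
      · rw [Function.update_of_ne]
        · simp [Word.eval]
        · intro h
          rw [Equiv.swap_apply_eq_iff, Equiv.swap_apply_right] at h
          exact Fin.succ_ne_zero j h
    rw [SetLike.mem_coe, heval, Units.smul_def]
    exact zsmul_mem (Submodule.subset_span (Set.mem_range_self (Equiv.ofBijective _ hbij))) _
  · rintro _ ⟨e, rfl⟩
    exact pairWord_mem_multilinear e

end FreeLAnKe

theorem LinearMap.map_intUnits_smul {M N : Type*} [AddCommGroup M] [AddCommGroup N]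
    [Module ℂ M] [Module ℂ N] (f : M →ₗ[ℂ] N) (u : ℤˣ) (v : M) : f (u • v) = u • f v :=
  map_zsmul f (u : ℤ) v

/-! ### Functionals on the multilinear component are harmonic functions. -/

namespace FreeLAnKe

open BooleanLattice

variable {k : ℕ} {α : Type*}

/-- `pairWord` as an element of the multilinear component. -/
def pairVec [Fintype α] [DecidableEq α] (e : Fin (k + 1) ⊕ Fin k ≃ α) : (multilinear (k + 1) α).toSubmodule :=
  ⟨pairWord e, pairWord_mem_multilinear e⟩

/-- The set of letters in the outer bracket of `pairWord`. -/
def outerSet [DecidableEq α] (e : Fin (k + 1) ⊕ Fin k ≃ α) : Finset α :=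
  Finset.univ.image fun j => e (Sum.inr j)

/-- The sign of a labelling relative to the labelling `e₀`. -/
def labelSign (e₀ e : Fin (k + 1) ⊕ Fin k ≃ α) : ℤˣ := Equiv.Perm.sign (e.trans e₀.symm)

theorem labelSign_trans (e₀ e : Fin (k + 1) ⊕ Fin k ≃ α) (π : Equiv.Perm (Fin (k + 1) ⊕ Fin k)) :
    labelSign e₀ (π.trans e) = labelSign e₀ e * Equiv.Perm.sign π :=
  Equiv.Perm.sign_mul (e.trans e₀.symm : Equiv.Perm (Fin (k + 1) ⊕ Fin k)) π

theorem mem_outerSet [DecidableEq α] {e : Fin (k + 1) ⊕ Fin k ≃ α} {x : α} :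
    x ∈ outerSet e ↔ ∃ j, e.symm x = Sum.inr j := by
  simp only [outerSet, Finset.mem_image, Finset.mem_univ, true_and, Equiv.symm_apply_eq]
  exact exists_congr fun _ => eq_comm

theorem card_outerSet [DecidableEq α] (e : Fin (k + 1) ⊕ Fin k ≃ α) : (outerSet e).card = k := by
  exact (Finset.card_image_of_injective _ (e.injective.comp Sum.inr_injective)).trans (by simp)

theorem compl_outerSet [Fintype α] [DecidableEq α] (e : Fin (k + 1) ⊕ Fin k ≃ α) :
    (outerSet e)ᶜ = Finset.univ.image fun i => e (Sum.inl i) := by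
  ext x
  obtain ⟨b, rfl⟩ := e.surjective x
  rw [Finset.mem_compl, mem_outerSet]
  rcases b with b | b <;> simp

theorem exists_outerSet_eq [DecidableEq α] (e₀ : Fin (k + 1) ⊕ Fin k ≃ α) {Y : Finset α} (hY : Y.card = k) :
    ∃ e : Fin (k + 1) ⊕ Fin k ≃ α, outerSet e = Y := by
  let f := (Finset.equivFinOfCardEq hY).symm
  obtain ⟨τ, hτ⟩ := Equiv.Perm.exists_extending_pair (fun j : Fin k => e₀ (Sum.inr j))
    (fun j => (f j : α)) (e₀.injective.comp Sum.inr_injective)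
    (Subtype.val_injective.comp f.injective)
  refine ⟨e₀.trans τ, ?_⟩
  ext x
  simp only [outerSet, Equiv.trans_apply, hτ, Finset.mem_image, Finset.mem_univ, true_and]
  constructor
  · rintro ⟨j, rfl⟩
    exact (f j).2
  · intro hx
    exact ⟨f.symm ⟨x, hx⟩, by simp⟩

/-- Labellings with the same outer set differ by a permutation that preserves the inner and the
outer positions, and antisymmetry turns it into its sign. This makes the vector `v_Y` well defined.
-/
theorem labelSign_smul_pairVec_eq [Fintype α] [DecidableEq α] (e₀ : Fin (k + 1) ⊕ Fin k ≃ α)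
    {e e' : Fin (k + 1) ⊕ Fin k ≃ α} (h : outerSet e = outerSet e') :
    labelSign e₀ e • pairVec e = labelSign e₀ e' • pairVec e' := by
  have hmaps : Set.MapsTo (e'.trans e.symm) (Set.range Sum.inl) (Set.range Sum.inl) := by
    rintro _ ⟨i, rfl⟩
    by_contra hi
    have h1 : e' (Sum.inl i) ∈ outerSet e := by
      rw [mem_outerSet]
      rcases hj : e.symm (e' (Sum.inl i)) with j | j
      · exact absurd ⟨j, hj.symm⟩ hi
      · exact ⟨j, rfl⟩
    rw [h, mem_outerSet] at h1
    simp at h1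
  obtain ⟨⟨σ, π⟩, hσ⟩ := Equiv.Perm.mem_sumCongrHom_range_of_perm_mapsTo_inl hmaps
  rw [Equiv.Perm.sumCongrHom_apply] at hσ
  have he : e' = (Equiv.Perm.sumCongr σ π).trans e := by
    rw [hσ]
    ext b
    simp
  rw [he, labelSign_trans, mul_smul]
  congr 1
  exact Subtype.ext (pairWord_sumCongr σ π e)

theorem pairVec_jacobi [Fintype α] [DecidableEq α] (e : Fin (k + 1) ⊕ Fin k ≃ α) :
    pairVec e = ∑ i, Equiv.Perm.sign (Equiv.swap 0 i) •
      pairVec ((exchange k).trans ((Equiv.sumCongr (Equiv.swap 0 i) (Equiv.refl _)).trans e)) := by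
  apply Subtype.ext
  simp only [AddSubmonoidClass.coe_finsetSum, Units.smul_def, SetLike.val_smul_of_tower]
  exact pairWord_jacobi e

/-- The sign of the swap cancels the one in `pairVec_jacobi`; only `sign (exchange k)`, independent
of `i` and `e`, survives. -/
theorem labelSign_jacobi (e₀ e : Fin (k + 1) ⊕ Fin k ≃ α) (i : Fin (k + 1)) :
    labelSign e₀
      ((exchange k).trans ((Equiv.sumCongr (Equiv.swap 0 i) (Equiv.refl _)).trans e)) =
    Equiv.Perm.sign (exchange k) * Equiv.Perm.sign (Equiv.swap 0 i) * labelSign e₀ e := by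
  rw [labelSign_trans, labelSign_trans]
  have : Equiv.Perm.sign (Equiv.sumCongr (Equiv.swap 0 i) (Equiv.refl (Fin k))) =
      Equiv.Perm.sign (Equiv.swap 0 i) := by
    rw [Equiv.Perm.sign_sumCongr]
    simp
  rw [this, mul_comm, mul_comm (labelSign e₀ e), mul_assoc]

theorem outerSet_jacobi [Fintype α] [DecidableEq α] (e : Fin (k + 1) ⊕ Fin k ≃ α) (i : Fin (k + 1)) :
    outerSet ((exchange k).trans ((Equiv.sumCongr (Equiv.swap 0 i) (Equiv.refl _)).trans e)) =
      (outerSet e)ᶜ.erase (e (Sum.inl i)) := by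
  rw [compl_outerSet]
  ext x
  obtain ⟨b, rfl⟩ := e.surjective x
  simp only [outerSet, Equiv.trans_apply, exchange_inr, Equiv.sumCongr_apply, Sum.map_inl,
    Finset.mem_image, Finset.mem_univ, true_and, Finset.mem_erase, ne_eq,
    EmbeddingLike.apply_eq_iff_eq]
  constructor
  · rintro ⟨j, rfl⟩
    refine ⟨fun h => ?_, _, rfl⟩
    rw [Sum.inl.injEq, Equiv.swap_apply_eq_iff, Equiv.swap_apply_right] at h
    exact Fin.succ_ne_zero j h
  · rintro ⟨h, j, rfl⟩
    have h0 : Equiv.swap 0 i j ≠ 0 := by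
      intro h'
      rw [Equiv.swap_apply_eq_iff, Equiv.swap_apply_left] at h'
      exact h (by rw [h'])
    obtain ⟨l, hl⟩ := Fin.exists_succ_eq.2 h0
    exact ⟨l, by rw [hl, Equiv.swap_apply_self]⟩

open Classical in
/-- The function on finite sets recording the values of a functional on the words `pairWord`. -/
def functionalFun [Fintype α] [DecidableEq α] (e₀ : Fin (k + 1) ⊕ Fin k ≃ α) :
    Module.Dual ℂ (multilinear (k + 1) α).toSubmodule →ₗ[ℂ] (Finset α → ℂ) where
  toFun φ Y := if h : ∃ e : Fin (k + 1) ⊕ Fin k ≃ α, outerSet e = Y then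
    φ (labelSign e₀ h.choose • pairVec h.choose) else 0
  map_add' φ ψ := by
    ext Y
    by_cases h : ∃ e : Fin (k + 1) ⊕ Fin k ≃ α, outerSet e = Y <;> simp [h]
  map_smul' c φ := by
    ext Y
    by_cases h : ∃ e : Fin (k + 1) ⊕ Fin k ≃ α, outerSet e = Y <;> simp [h, mul_smul_comm]

theorem functionalFun_outerSet [Fintype α] [DecidableEq α] (e₀ e : Fin (k + 1) ⊕ Fin k ≃ α)
    (φ : Module.Dual ℂ (multilinear (k + 1) α).toSubmodule) :
    functionalFun e₀ φ (outerSet e) = φ (labelSign e₀ e • pairVec e) := by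
  have h : ∃ e' : Fin (k + 1) ⊕ Fin k ≃ α, outerSet e' = outerSet e := ⟨e, rfl⟩
  change (if h : _ then _ else _) = _
  rw [dif_pos h, labelSign_smul_pairVec_eq e₀ h.choose_spec]

theorem functionalFun_mem_harmonic [Fintype α] [DecidableEq α] (e₀ : Fin (k + 1) ⊕ Fin k ≃ α)
    (hα : Fintype.card α = 2 * k + 1) (φ : Module.Dual ℂ (multilinear (k + 1) α).toSubmodule) :
    functionalFun e₀ φ ∈ harmonic α k := by
  have hlevel : functionalFun e₀ φ ∈ level α k := by
    intro Y hY
    refine dif_neg ?_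
    rintro ⟨e, rfl⟩
    exact hY (card_outerSet e)
  -- In the Jacobi identity the new outer sets are the `k`-subsets of the complement of the old one,
  -- so it is the disjoint-sum equation with `ε` the sign of `exchange k`.
  refine ⟨hlevel, down_eq_zero_of_disjoint_sum hα hlevel
    (ε := ((Equiv.Perm.sign (exchange k) : ℤ) : ℂ)) ?_ ?_⟩
  · rcases Int.units_eq_one_or (Equiv.Perm.sign (exchange k)) with h | h <;> simp [h]
  · intro Y hY
    obtain ⟨e, rfl⟩ := exists_outerSet_eq e₀ hY
    rw [up_apply, Finset.mul_sum]
    rw [Finset.sum_congr (compl_outerSet e) fun _ _ => rfl, Finset.sum_image (fun i _ j _ h => Sum.inl_injective (e.injective h)),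
      functionalFun_outerSet]
    conv_lhs => rw [pairVec_jacobi, Finset.smul_sum, map_sum]
    refine Finset.sum_congr rfl fun i _ => ?_
    rw [← outerSet_jacobi, functionalFun_outerSet, labelSign_jacobi, ← smul_eq_mul,
      Int.cast_smul_eq_zsmul, ← Units.smul_def, ← LinearMap.map_intUnits_smul, smul_smul, smul_smul,
      ← mul_assoc, ← mul_assoc, Int.units_mul_self, one_mul, mul_comm]

/-- The dual embeds in the harmonic functions, because a functional vanishing on all double brackets
is zero. -/
theorem finrank_multilinear_le [Fintype α] [DecidableEq α] (e₀ : Fin (k + 1) ⊕ Fin k ≃ α) (hk : 1 ≤ k)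
    (hα : Fintype.card α = 2 * k + 1) :
    Module.finrank ℂ (multilinear (k + 1) α).toSubmodule ≤
      Module.finrank ℂ (harmonic α k) := by
  have : FiniteDimensional ℂ (multilinear (k + 1) α).toSubmodule := by
    rw [multilinear_eq_span_pairWord hk hα]
    exact FiniteDimensional.span_of_finite ℂ (Set.finite_range _)
  rw [← Subspace.dual_finrank_eq]
  refine LinearMap.finrank_le_finrank_of_injective
    (f := (functionalFun e₀).codRestrict (harmonic α k) (functionalFun_mem_harmonic e₀ hα)) ?_
  rw [← LinearMap.ker_eq_bot, LinearMap.ker_codRestrict, LinearMap.ker_eq_bot']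
  intro φ hφ
  have hv : ∀ e : Fin (k + 1) ⊕ Fin k ≃ α, φ (pairVec e) = 0 := by
    intro e
    have h := functionalFun_outerSet e₀ e φ
    rw [hφ, LinearMap.map_intUnits_smul, Pi.zero_apply, eq_comm, smul_eq_zero_iff_eq] at h
    exact h
  ext ⟨v, hv'⟩
  rw [LinearMap.zero_apply]
  have hv'' := hv'
  rw [multilinear_eq_span_pairWord hk hα] at hv''
  induction hv'' using Submodule.span_induction with
  | mem a ha =>
    obtain ⟨e, rfl⟩ := ha
    exact hv e
  | zero => exact map_zero φ
  | add a b ha hb iha ihb =>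
    rw [← multilinear_eq_span_pairWord hk hα] at ha hb
    have := congrArg₂ (· + ·) (iha ha) (ihb hb)
    rw [← map_add, add_zero] at this
    exact this
  | smul c a ha iha =>
    rw [← multilinear_eq_span_pairWord hk hα] at ha
    have := congrArg (c • ·) (iha ha)
    rw [← map_smul, smul_zero] at this
    exact this

end FreeLAnKe

/-! ### A determinantal LAnKe used as a test object. -/

/-- The `n`-ary bracket `[x₁,…,xₙ] = det (x₁,…,xₙ) • v` on `ℂⁿ`. -/
abbrev detLAnKe {n : ℕ} (v : Fin n → ℂ) : LAnKe n (Fin n → ℂ) where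
  bracket := (Matrix.detRowAlternating (n := Fin n) (R := ℂ)).toMultilinearMap.smulRight v
  antisymm σ x := by
    have h := (Matrix.detRowAlternating (n := Fin n) (R := ℂ)).map_perm x σ
    simp only [MultilinearMap.smulRight_apply, AlternatingMap.coe_multilinearMap]
    change _ = Equiv.Perm.sign σ • (Matrix.detRowAlternating (x ∘ σ) • v)
    rw [h, Units.smul_def, Units.smul_def, ← smul_assoc, smul_smul,
      ← Units.val_mul, Int.units_mul_self, Units.val_one, one_smul]
  jacobi h x y := by
    let D := Matrix.detRowAlternating (n := Fin n) (R := ℂ)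
    -- Cramer's rule. Substituting it into the first slot of the outer determinant gives the Jacobi
    -- identity.
    have hc : D x • v = ∑ i, D (Function.update x i v) • x i := by
      have h1 := Matrix.mulVec_cramer (Matrix.of x).transpose v
      rw [Matrix.det_transpose] at h1
      rw [show D x • v = (Matrix.of x).det • v from rfl, ← h1]
      ext j
      simp only [Matrix.mulVec, dotProduct, Matrix.transpose_apply, Matrix.of_apply,
        Matrix.cramer_transpose_apply, Finset.sum_apply, Pi.smul_apply, smul_eq_mul]
      exact Finset.sum_congr rfl fun i _ => mul_comm _ _
    simp only [MultilinearMap.smulRight_apply, AlternatingMap.coe_multilinearMap]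
    change D (Function.update y ⟨0, h⟩ (D x • v)) • v = ∑ i, D (Function.update x i
      (D (Function.update y ⟨0, h⟩ (x i)) • v)) • v
    rw [hc, D.map_update_sum, Finset.sum_smul]
    refine Finset.sum_congr rfl fun i _ => ?_
    rw [D.map_update_smul, D.map_update_smul, smul_eq_mul, smul_eq_mul, mul_comm]

namespace FreeLAnKe

variable {k : ℕ}

/-- The row indices of the positions in `pairWord`, when its letters fill a diagram of shape
`2^k 1` by columns, the additional cell coming first. -/
def rowIndex : Fin (k + 1) ⊕ Fin k → Fin (k + 1) := Sum.elim id Fin.succ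

/-- The value of the word `pairWord` in the LAnKe `detLAnKe` on basis vectors with indices `f`. -/
def rowDet (f : Fin (k + 1) ⊕ Fin k → Fin (k + 1)) : ℂ :=
  Matrix.det (Matrix.of fun i => (Pi.single (f (Sum.inl i)) 1 : Fin (k + 1) → ℂ)) *
    Matrix.det (Matrix.of (Fin.cons (Pi.single 0 1) fun j => Pi.single (f (Sum.inr j)) 1 :
      Fin (k + 1) → Fin (k + 1) → ℂ))

theorem pairBracket_detLAnKe (f : Fin (k + 1) ⊕ Fin k → Fin (k + 1)) :
    letI := detLAnKe (Pi.single 0 1 : Fin (k + 1) → ℂ)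
    LAnKe.pairBracket (fun i => (Pi.single (f (Sum.inl i)) 1 : Fin (k + 1) → ℂ))
      (fun j => Pi.single (f (Sum.inr j)) 1) = rowDet f • (Pi.single 0 1 : Fin (k + 1) → ℂ) := by
  let D := Matrix.detRowAlternating (n := Fin (k + 1)) (R := ℂ)
  let v : Fin (k + 1) → ℂ := Pi.single 0 1
  change D (Fin.cons (D (fun i => Pi.single (f (Sum.inl i)) 1) • v) fun j =>
    Pi.single (f (Sum.inr j)) 1) • v = _
  have h := D.map_update_smul (Fin.cons 0 fun j => Pi.single (f (Sum.inr j)) 1) 0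
    (D (fun i => Pi.single (f (Sum.inl i)) 1)) v
  rw [Fin.update_cons_zero, Fin.update_cons_zero] at h
  rw [h]
  rfl

theorem lift_pairWord {α : Type*} (r : α → Fin (k + 1)) (e : Fin (k + 1) ⊕ Fin k → α) :
    letI := detLAnKe (Pi.single 0 1 : Fin (k + 1) → ℂ)
    (lift fun x => (Pi.single (r x) 1 : Fin (k + 1) → ℂ)).toLinearMap (pairWord e) =
      rowDet (r ∘ e) • (Pi.single 0 1 : Fin (k + 1) → ℂ) := by
  let _ := detLAnKe (Pi.single 0 1 : Fin (k + 1) → ℂ)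
  rw [pairWord, LAnKeHom.map_pairBracket]
  exact pairBracket_detLAnKe (r ∘ e)

theorem rowDet_sumCongr (f : Fin (k + 1) ⊕ Fin k → Fin (k + 1))
    (σ : Equiv.Perm (Fin (k + 1))) (π : Equiv.Perm (Fin k)) :
    rowDet (f ∘ Equiv.sumCongr σ π) =
      ((Equiv.Perm.sign (Equiv.sumCongr σ π) : ℤ) : ℂ) * rowDet f := by
  let _ := detLAnKe (Pi.single 0 1 : Fin (k + 1) → ℂ)
  have h := LAnKe.pairBracket_perm σ π
    (fun i => (Pi.single (f (Sum.inl i)) 1 : Fin (k + 1) → ℂ))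
    (fun j => (Pi.single (f (Sum.inr j)) 1 : Fin (k + 1) → ℂ))
  have h1 := pairBracket_detLAnKe f
  have h2 := pairBracket_detLAnKe (f ∘ Equiv.sumCongr σ π)
  rw [h1] at h
  have h3 := h.trans (congrArg _ h2)
  have h4 := congrFun h3 0
  rw [Equiv.Perm.sign_sumCongr]
  simp only [Pi.smul_apply, Pi.single_eq_same, Units.smul_def, zsmul_eq_mul, smul_eq_mul,
    mul_one] at h4
  rw [h4, ← mul_assoc, ← Int.cast_mul, ← Units.val_mul, Int.units_mul_self]
  simp

theorem rowDet_rowIndex : rowDet (rowIndex (k := k)) = 1 := by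
  have h1 : (Matrix.of fun i => (Pi.single (rowIndex (k := k) (Sum.inl i)) 1 :
      Fin (k + 1) → ℂ)) = 1 := by
    ext i j
    simp [rowIndex, Matrix.one_apply, Pi.single_apply, eq_comm]
  have h2 : Matrix.of (Fin.cons (Pi.single 0 1) fun j => Pi.single
      (rowIndex (k := k) (Sum.inr j)) 1 : Fin (k + 1) → Fin (k + 1) → ℂ) = 1 := by
    ext i j
    refine Fin.cases ?_ (fun i => ?_) i <;>
    simp [rowIndex, Matrix.one_apply, Pi.single_apply, eq_comm]
  rw [rowDet, h1, h2, Matrix.det_one, mul_one]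

/-- A determinant with a repeated row vanishes. The second one has `e₀` as its first row, so the
outer indices must be distinct and nonzero. -/
theorem exists_sumCongr_of_rowDet_ne_zero {f : Fin (k + 1) ⊕ Fin k → Fin (k + 1)}
    (h : rowDet f ≠ 0) :
    ∃ (σ : Equiv.Perm (Fin (k + 1))) (π : Equiv.Perm (Fin k)),
      f = rowIndex ∘ Equiv.sumCongr σ π := by
  have hinj1 : Function.Injective fun i => f (Sum.inl i) := by
    intro i j hij
    by_contra hne
    refine h ?_
    rw [rowDet, Matrix.det_zero_of_row_eq hne, zero_mul]
    exact congrArg (fun a => (Pi.single a 1 : Fin (k + 1) → ℂ)) hij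
  have hinj2 : Function.Injective
      (Fin.cons 0 (fun j => f (Sum.inr j)) : Fin (k + 1) → Fin (k + 1)) := by
    intro i j hij
    by_contra hne
    refine h ?_
    have : (Fin.cons (Pi.single 0 1) fun j => Pi.single (f (Sum.inr j)) 1 :
        Fin (k + 1) → Fin (k + 1) → ℂ) = fun i => Pi.single
          ((Fin.cons 0 (fun j => f (Sum.inr j)) : Fin (k + 1) → Fin (k + 1)) i) 1 := by
      funext i
      refine Fin.cases ?_ (fun i => ?_) i <;> simp
    rw [rowDet, this, mul_eq_zero]
    exact Or.inr (Matrix.det_zero_of_row_eq hne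
      (congrArg (fun a => (Pi.single a 1 : Fin (k + 1) → ℂ)) hij))
  rw [Fin.cons_injective_iff] at hinj2
  have hex : ∀ j, ∃ l : Fin k, l.succ = f (Sum.inr j) := fun j =>
    Fin.exists_succ_eq.2 fun h0 => hinj2.1 ⟨j, h0⟩
  choose p hp using hex
  have hpinj : Function.Injective p := fun i j hij => hinj2.2 (by
    dsimp only
    rw [← hp, ← hp, hij])
  refine ⟨Equiv.ofBijective _ (Finite.injective_iff_bijective.1 hinj1),
    Equiv.ofBijective _ (Finite.injective_iff_bijective.1 hpinj), ?_⟩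
  funext b
  rcases b with i | j
  · rfl
  · exact (hp j).symm

end FreeLAnKe

/-! ### The Specht module paired with the free LAnKe and with harmonic functions. -/

/-- The linear map from the group algebra sending each group element `g` to `w g`. -/
def MonoidAlgebra.pairing {G V : Type*} [AddCommGroup V] [Module ℂ V] (w : G → V) :
    MonoidAlgebra ℂ G →ₗ[ℂ] V :=
  Finsupp.linearCombination ℂ w ∘ₗ (MonoidAlgebra.coeffLinearEquiv ℂ).toLinearMap

theorem MonoidAlgebra.pairing_single {G V : Type*} [AddCommGroup V] [Module ℂ V] (w : G → V)
    (g : G) (c : ℂ) : MonoidAlgebra.pairing w (MonoidAlgebra.single g c) = c • w g := by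
  simp [MonoidAlgebra.pairing]

theorem MonoidAlgebra.pairing_eq_sum {G V : Type*} [Fintype G] [AddCommGroup V] [Module ℂ V]
    (w : G → V) (y : MonoidAlgebra ℂ G) :
    MonoidAlgebra.pairing w y = ∑ g, y.coeff g • w g := by
  simp [MonoidAlgebra.pairing, Finsupp.linearCombination_apply, Finsupp.sum_fintype]

namespace YoungTableau

open BooleanLattice FreeLAnKe MonoidAlgebra

variable {μ : YoungDiagram} {m : ℕ} (t : YoungTableau μ m)

theorem pairing_single_mul_symmetrizer {V : Type*} [AddCommGroup V] [Module ℂ V]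
    (w : Equiv.Perm (Fin m) → V) (τ : Equiv.Perm (Fin m)) :
    pairing w (single τ (1 : ℂ) * t.symmetrizer) =
      ∑ a ∈ t.rowStabilizer, ∑ b ∈ t.colStabilizer,
        ((Equiv.Perm.sign b : ℤ) : ℂ) • w (τ * (a * b)) := by
  rw [symmetrizer, Finset.sum_mul_sum, Finset.mul_sum]
  simp only [Finset.mul_sum, single_mul_single, map_sum, pairing_single, one_mul]

theorem mem_rowStabilizer {σ : Equiv.Perm (Fin m)} :
    σ ∈ t.rowStabilizer ↔ ∀ x, t.row (σ x) = t.row x := by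
  simp [rowStabilizer]

theorem mem_colStabilizer {σ : Equiv.Perm (Fin m)} :
    σ ∈ t.colStabilizer ↔ ∀ x, t.col (σ x) = t.col x := by
  simp [colStabilizer]

theorem eq_of_row_eq_of_col_eq {x y : Fin m} (hr : t.row x = t.row y) (hc : t.col x = t.col y) :
    x = y :=
  t.symm.injective (Subtype.ext (Prod.ext hr hc))

theorem mul_injOn_rowStabilizer_colStabilizer {a b a' b' : Equiv.Perm (Fin m)}
    (ha : a ∈ t.rowStabilizer) (hb : b ∈ t.colStabilizer) (ha' : a' ∈ t.rowStabilizer)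
    (hb' : b' ∈ t.colStabilizer) (h : a * b = a' * b') : a = a' ∧ b = b' := by
  rw [mem_rowStabilizer] at ha ha'
  rw [mem_colStabilizer] at hb hb'
  have hbb : b = b' := by
    ext1 x
    have hx : a (b x) = a' (b' x) := congrArg (fun π : Equiv.Perm (Fin m) => π x) h
    refine t.eq_of_row_eq_of_col_eq ?_ ?_
    · rw [← ha, hx, ha']
    · rw [hb, hb']
  subst hbb
  exact ⟨mul_right_cancel h, rfl⟩

/-- An element of the Specht module is zero if all its pairings with the spanning elements
`τ e_t` vanish. -/
theorem eq_zero_of_mem_specht {y : MonoidAlgebra ℂ (Equiv.Perm (Fin m))}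
    (hy : y ∈ t.specht.toSubmodule)
    (h : ∀ τ : Equiv.Perm (Fin m), ∑ a ∈ t.rowStabilizer, ∑ b ∈ t.colStabilizer,
      ((Equiv.Perm.sign b : ℤ) : ℂ) • y.coeff (τ * (a * b)) = 0) : y = 0 := by
  -- The hypothesis says that `y` is orthogonal to the span of the `τ e_t`, whose coefficients are
  -- real. As `y` lies in that span, `⟨y, y⟩ = 0`.
  have key : ∀ z ∈ t.specht.toSubmodule, ∑ σ, y.coeff σ * star (z.coeff σ) = 0 := by
    intro z hz
    induction hz using Submodule.span_induction with
    | mem z hz =>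
      obtain ⟨τ, rfl⟩ := hz
      have hreal : ∀ σ, star ((single τ (1 : ℂ) * t.symmetrizer).coeff σ) =
          (single τ (1 : ℂ) * t.symmetrizer).coeff σ := by
        intro σ
        have hc : ∀ z : MonoidAlgebra ℂ (Equiv.Perm (Fin m)),
            z.coeff σ = pairing (fun g => if g = σ then (1 : ℂ) else 0) z := by
          intro z
          rw [pairing_eq_sum]
          simp
        rw [hc, pairing_single_mul_symmetrizer, star_sum]
        refine Finset.sum_congr rfl fun a _ => ?_
        rw [star_sum]
        refine Finset.sum_congr rfl fun b _ => ?_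
        split_ifs <;> simp
      have h1 := h τ
      rw [← t.pairing_single_mul_symmetrizer (fun g => y.coeff g), pairing_eq_sum] at h1
      simp only [hreal]
      rw [← h1]
      exact Finset.sum_congr rfl fun σ _ => mul_comm _ _
    | zero => simp
    | add z z' _ _ hz hz' =>
      simp only [coeff_add, Finsupp.add_apply, star_add, mul_add, Finset.sum_add_distrib, hz, hz',
        add_zero]
    | smul c z _ hz =>
      simp only [coeff_smul_apply, star_smul, mul_smul_comm, ← Finset.smul_sum, hz, smul_zero]
  open scoped ComplexOrder in
  have h0 := dotProduct_self_star_eq_zero.1 (key y hy)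
  refine MonoidAlgebra.coeff_injective (Finsupp.ext fun σ => ?_)
  exact congrFun h0 σ

variable {k : ℕ} {t}

variable (t) in
/-- A labelling of the tableau `t` of shape `2^k 1`: the first column is listed by the left
summand, starting with the last row, and the second column by the right summand. -/
structure IsLabelling (e : Fin (k + 1) ⊕ Fin k ≃ Fin m) : Prop where
  row_iff (b b') : t.row (e b) = t.row (e b') ↔ rowIndex b = rowIndex b'
  col_iff (b b') : t.col (e b) = t.col (e b') ↔ b.isLeft = b'.isLeft

variable {e : Fin (k + 1) ⊕ Fin k ≃ Fin m}

theorem permCongr_sumCongr_mem_colStabilizer (he : t.IsLabelling e) (σ : Equiv.Perm (Fin (k + 1)))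
    (π : Equiv.Perm (Fin k)) : e.permCongr (Equiv.sumCongr σ π) ∈ t.colStabilizer := by
  rw [mem_colStabilizer]
  intro x
  obtain ⟨b, rfl⟩ := e.surjective x
  rw [Equiv.permCongr_apply, Equiv.symm_apply_apply, he.col_iff]
  rcases b with b | b <;> rfl

theorem exists_permCongr_sumCongr (he : t.IsLabelling e) {β : Equiv.Perm (Fin m)} (hβ : β ∈ t.colStabilizer) :
    ∃ (σ : Equiv.Perm (Fin (k + 1))) (π : Equiv.Perm (Fin k)),
      e.permCongr (Equiv.sumCongr σ π) = β := by
  rw [mem_colStabilizer] at hβ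
  have hmaps : Set.MapsTo (e.symm.permCongr β) (Set.range Sum.inl) (Set.range Sum.inl) := by
    rintro _ ⟨i, rfl⟩
    have h : t.col (e (e.symm.permCongr β (Sum.inl i))) = t.col (e (Sum.inl i)) := by
      rw [Equiv.permCongr_apply, Equiv.apply_symm_apply, Equiv.symm_symm, hβ]
    rw [he.col_iff, Sum.isLeft_inl, Sum.isLeft_iff] at h
    obtain ⟨j, hj⟩ := h
    exact ⟨j, hj.symm⟩
  obtain ⟨⟨σ, π⟩, hσ⟩ := Equiv.Perm.mem_sumCongrHom_range_of_perm_mapsTo_inl hmaps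
  refine ⟨σ, π, ?_⟩
  rw [Equiv.Perm.sumCongrHom_apply] at hσ
  rw [show Equiv.sumCongr σ π = e.symm.permCongr β from hσ]
  ext x
  simp [Equiv.permCongr_apply]

/-- The determinant attached to `σ` is nonzero exactly when `σ = a b` with `a` in the row and `b` in
the column stabilizer; the factorisation is unique and the value is `sgn b`. So these determinants
are the coefficients of `e_t`. -/
theorem sum_mul_rowDet (he : t.IsLabelling e) (c : Equiv.Perm (Fin m) → ℂ) :
    ∑ σ, c σ * rowDet (rowIndex ∘ e.symm ∘ σ ∘ e) =
      ∑ a ∈ t.rowStabilizer, ∑ b ∈ t.colStabilizer,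
        ((Equiv.Perm.sign b : ℤ) : ℂ) • c (a * b) := by
  rw [← Finset.sum_product']
  symm
  refine Finset.sum_of_injOn (fun p => p.1 * p.2) ?_ ?_ ?_ ?_
  · rintro ⟨a, b⟩ h ⟨a', b'⟩ h' heq
    simp only [Finset.coe_product, Set.mem_prod, Finset.mem_coe] at h h'
    exact Prod.ext_iff.2
      (t.mul_injOn_rowStabilizer_colStabilizer h.1 h.2 h'.1 h'.2 heq)
  · intro _ _
    simp
  · intro σ _ hσ
    by_contra hne
    obtain ⟨s, π, hf⟩ := exists_sumCongr_of_rowDet_ne_zero (right_ne_zero_of_mul hne)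
    refine hσ ⟨(σ * (e.permCongr (Equiv.sumCongr s π))⁻¹, e.permCongr (Equiv.sumCongr s π)),
      ?_, by simp⟩
    simp only [Finset.coe_product, Set.mem_prod, Finset.mem_coe]
    refine ⟨?_, permCongr_sumCongr_mem_colStabilizer he s π⟩
    rw [mem_rowStabilizer]
    intro x
    obtain ⟨y, rfl⟩ := (e.permCongr (Equiv.sumCongr s π)).surjective x
    obtain ⟨b, rfl⟩ := e.surjective y
    rw [Equiv.Perm.mul_apply, Equiv.Perm.inv_def, Equiv.symm_apply_apply, Equiv.permCongr_apply,
      Equiv.symm_apply_apply, ← e.apply_symm_apply (σ (e b)), he.row_iff]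
    exact congrFun hf b
  · rintro ⟨a, b⟩ h
    simp only [Finset.mem_product] at h
    obtain ⟨s, π, rfl⟩ := exists_permCongr_sumCongr he h.2
    have hf : rowIndex ∘ e.symm ∘ (a * e.permCongr (Equiv.sumCongr s π) :
        Equiv.Perm (Fin m)) ∘ e = rowIndex ∘ Equiv.sumCongr s π := by
      funext b
      simp only [Function.comp_apply]
      rw [← he.row_iff, Equiv.apply_symm_apply, Equiv.Perm.mul_apply,
        t.mem_rowStabilizer.1 h.1, Equiv.permCongr_apply, Equiv.symm_apply_apply]
    rw [hf, rowDet_sumCongr, rowDet_rowIndex, mul_one, Equiv.Perm.sign_permCongr, smul_eq_mul,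
      mul_comm]

/-- The map `y ↦ y · w` from the Specht module to the free LAnKe, for `w` the word `pairWord` read
off the columns of the tableau, is injective. -/
theorem eq_zero_of_pairing_pairWord_eq_zero (he : t.IsLabelling e) {y : MonoidAlgebra ℂ (Equiv.Perm (Fin m))}
    (hy : y ∈ t.specht.toSubmodule) 
    (h : pairing (fun σ : Equiv.Perm (Fin m) => pairWord (σ ∘ e)) y = 0) : y = 0 := by
  refine t.eq_zero_of_mem_specht hy fun τ => ?_
  -- After reindexing by `τ⁻¹`, the pairing with `τ e_t` is the coordinate at `0` of the image of `y
  -- · w` when each letter `x` is sent to the basis vector indexed by the row of `τ⁻¹ x`.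
  rw [← sum_mul_rowDet he (fun σ => y.coeff (τ * σ)),
    ← Equiv.sum_comp (Equiv.mulLeft τ⁻¹)]
  simp only [Equiv.coe_mulLeft, mul_inv_cancel_left]
  let _ := detLAnKe (Pi.single 0 1 : Fin (k + 1) → ℂ)
  have h1 := congrArg (lift fun x => (Pi.single (rowIndex (e.symm (τ⁻¹ x))) 1 :
    Fin (k + 1) → ℂ)).toLinearMap h
  rw [pairing_eq_sum, map_sum, map_zero] at h1
  have h2 := congrFun h1 0
  rw [Finset.sum_apply] at h2
  refine (Finset.sum_congr rfl fun σ _ => ?_).trans h2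
  rw [map_smul, lift_pairWord]
  simp only [Pi.smul_apply, Pi.single_eq_same, smul_eq_mul, mul_one]
  rfl

theorem image_colStabilizer (he : t.IsLabelling e) {b : Equiv.Perm (Fin m)} (hb : b ∈ t.colStabilizer)
    (σ : Equiv.Perm (Fin m)) :
    (Finset.univ.image fun j : Fin k => (σ * b) (e (Sum.inr j))) =
      Finset.univ.image fun j : Fin k => σ (e (Sum.inr j)) := by
  obtain ⟨s, π, rfl⟩ := exists_permCongr_sumCongr he hb
  ext x
  simp only [Finset.mem_image, Finset.mem_univ, true_and, Equiv.Perm.mul_apply,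
    Equiv.permCongr_apply, Equiv.symm_apply_apply, Equiv.sumCongr_apply, Sum.map_inr]
  exact π.exists_congr_left.trans (by simp)

/-- Harmonic functions embed in the dual of the Specht module: if the functional of `g` kills every
`τ e_t`, then the signed row sums of `g` vanish, and `g = 0`. -/
theorem finrank_harmonic_le_finrank_specht (he : t.IsLabelling e) :
    Module.finrank ℂ (harmonic (Fin m) k) ≤ Module.finrank ℂ t.specht.toSubmodule := by
  have : FiniteDimensional ℂ t.specht.toSubmodule :=
    FiniteDimensional.span_of_finite ℂ (Set.finite_range _)
  rw [← Subspace.dual_finrank_eq (V := t.specht.toSubmodule)]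
  -- The factor `sgn σ` cancels the `sgn b` in `e_t`, while `b` preserves the second column. The
  -- column sum thus only contributes the nonzero factor `|C_t|`, and the rows acquire signs.
  let w : (Finset (Fin m) → ℂ) → Equiv.Perm (Fin m) → ℂ := fun g σ =>
    ((Equiv.Perm.sign σ : ℤ) : ℂ) * g (Finset.univ.image fun j : Fin k => σ (e (Sum.inr j)))
  let P : harmonic (Fin m) k →ₗ[ℂ] Module.Dual ℂ t.specht.toSubmodule :=
    { toFun := fun g => pairing (w g.1) ∘ₗ t.specht.toSubmodule.subtype
      map_add' := fun g g' => by
        ext y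
        simp [pairing_eq_sum, w, mul_add, Finset.sum_add_distrib]
      map_smul' := fun c g => by
        ext y
        simp only [pairing_eq_sum, w, LinearMap.comp_apply, LinearMap.smul_apply, smul_eq_mul,
          Finset.mul_sum, RingHom.id_apply, Submodule.coe_smul, Pi.smul_apply]
        exact Finset.sum_congr rfl fun σ _ => by ring }
  refine LinearMap.finrank_le_finrank_of_injective (f := P) ?_
  rw [← LinearMap.ker_eq_bot, LinearMap.ker_eq_bot']
  rintro ⟨g, hg⟩ hP
  refine Subtype.ext ?_
  -- `true` marks the second column, and `none`, the cell alone in its row, is `Sum.inl 0`.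
  let c : Cell k ≃ Fin (k + 1) ⊕ Fin k :=
    { toFun := fun x => x.elim (Sum.inl 0) fun p =>
        if p.2 then Sum.inr p.1 else Sum.inl p.1.succ
      invFun := Sum.elim (Fin.cases none fun i => some (i, false)) fun j => some (j, true)
      left_inv := by rintro (_ | ⟨i, _ | _⟩) <;> simp
      right_inv := by
        rintro (i | j)
        · refine Fin.cases ?_ (fun i => ?_) i <;> simp
        · simp }
  refine eq_zero_of_sum_rowStabilizer_eq_zero (c.trans e) t.row ?_ hg fun τ => ?_
  · intro b b'
    rw [Equiv.trans_apply, Equiv.trans_apply, he.row_iff]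
    rcases b with _ | ⟨i, _ | _⟩ <;> rcases b' with _ | ⟨i', _ | _⟩ <;>
      simp [c, rowIndex, Fin.succ_ne_zero, (Fin.succ_ne_zero _).symm]
  · have h := LinearMap.congr_fun hP ⟨single τ (1 : ℂ) * t.symmetrizer,
      Submodule.subset_span ⟨τ, rfl⟩⟩
    change pairing (w g) (single τ (1 : ℂ) * t.symmetrizer) = 0 at h
    rw [pairing_single_mul_symmetrizer] at h
    have hterm : ∀ a ∈ t.rowStabilizer, ∑ b ∈ t.colStabilizer,
        ((Equiv.Perm.sign b : ℤ) : ℂ) • w g (τ * (a * b)) =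
        (t.colStabilizer.card * ((Equiv.Perm.sign τ : ℤ) : ℂ)) *
          (((Equiv.Perm.sign a : ℤ) : ℂ) *
          g (Finset.univ.image fun i : Fin k => τ (a (e (Sum.inr i))))) := by
      intro a _
      rw [mul_assoc, ← nsmul_eq_mul, ← Finset.sum_const]
      refine Finset.sum_congr rfl fun b hb => ?_
      simp only [w]
      rw [← mul_assoc τ a b, image_colStabilizer he hb, Equiv.Perm.sign_mul,
        Equiv.Perm.sign_mul, smul_eq_mul]
      have hb2 : ((Equiv.Perm.sign b : ℤ) : ℂ) * ((Equiv.Perm.sign b : ℤ) : ℂ) = 1 := by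
        rw [← Int.cast_mul, ← Units.val_mul, Int.units_mul_self]
        simp
      simp only [Equiv.Perm.mul_apply, Units.val_mul, Int.cast_mul]
      linear_combination (((Equiv.Perm.sign τ : ℤ) : ℂ) * ((Equiv.Perm.sign a : ℤ) : ℂ) *
        g (Finset.univ.image fun i : Fin k => τ (a (e (Sum.inr i))))) * hb2
    rw [Finset.sum_congr rfl hterm, ← Finset.mul_sum, mul_eq_zero, mul_eq_zero] at h
    rcases h with (h | h) | h
    · have h1 : (1 : Equiv.Perm (Fin m)) ∈ t.colStabilizer := by simp [mem_colStabilizer]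
      rw [Nat.cast_eq_zero, Finset.card_eq_zero] at h
      rw [h] at h1
      simp at h1
    · simp at h
    · convert h
      · ext a
        simp [mem_rowStabilizer]
      · simp [c]

end YoungTableau

/-! ### Labellings of the shape, the intertwiner, and the dimension count. -/

namespace YoungTableau

open BooleanLattice FreeLAnKe MonoidAlgebra

theorem exists_isLabelling {k m : ℕ} (t : YoungTableau (twoOneDiagram (k + 1)) m) :
    ∃ e : Fin (k + 1) ⊕ Fin k ≃ Fin m, t.IsLabelling e := by
  -- `rowIndex` cyclically shifts the rows of the diagram: the last row `k` has index `0`, and row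
  -- `j < k` has index `j + 1`.
  let f : Fin (k + 1) ⊕ Fin k → ℕ × ℕ :=
    Sum.elim (fun i => Fin.cases (k, 0) (fun j => ((j : ℕ), 0)) i) fun j => (j, 1)
  have hmem : ∀ b, f b ∈ (twoOneDiagram (k + 1)).cells := by
    rintro (i | j)
    · refine Fin.cases ?_ (fun i => ?_) i <;> rw [mem_twoOneDiagram] <;> simp
    · rw [mem_twoOneDiagram]
      simp
  have hrow : ∀ b b', (f b).1 = (f b').1 ↔ rowIndex b = rowIndex b' := by
    have hr : ∀ b, (f b).1 = (Fin.cases k (fun j => (j : ℕ)) (rowIndex b) : ℕ) := by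
      rintro (i | j)
      · refine Fin.cases ?_ (fun i => ?_) i <;> simp [f, rowIndex]
      · simp [f, rowIndex]
    have hinj : Function.Injective (fun i : Fin (k + 1) => (Fin.cases k (fun j => (j : ℕ)) i : ℕ))
      := by
      intro i j
      refine Fin.cases ?_ (fun i => ?_) i <;> refine Fin.cases ?_ (fun j => ?_) j
      · simp
      · intro h
        exact absurd h j.2.ne'
      · intro h
        exact absurd h i.2.ne
      · intro h
        exact congrArg Fin.succ (Fin.ext h)
    intro b b'
    rw [hr, hr]
    exact hinj.eq_iff
  have hcol : ∀ b b', (f b).2 = (f b').2 ↔ b.isLeft = b'.isLeft := by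
    have hc : ∀ b, (f b).2 = if b.isLeft then 0 else 1 := by
      rintro (i | j)
      · refine Fin.cases ?_ (fun i => ?_) i <;> simp [f]
      · simp [f]
    intro b b'
    rw [hc, hc]
    cases b.isLeft <;> cases b'.isLeft <;> simp
  have hbij : Function.Bijective
      (fun b => (⟨f b, hmem b⟩ : {c // c ∈ (twoOneDiagram (k + 1)).cells})) := by
    rw [Fintype.bijective_iff_injective_and_card]
    constructor
    · intro b b' h
      have h1 := (hrow b b').1 (congrArg (fun c => c.1.1) h)
      have h2 := (hcol b b').1 (congrArg (fun c => c.1.2) h)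
      rcases b with b | b <;> rcases b' with b' | b'
      · exact congrArg Sum.inl h1
      · simp at h2
      · simp at h2
      · exact congrArg Sum.inr (Fin.succ_injective _ h1)
    · rw [Fintype.card_coe]
      have h := card_twoOneDiagram (k + 1) (by omega)
      rw [YoungDiagram.card] at h
      rw [h, Fintype.card_sum, Fintype.card_fin, Fintype.card_fin]
      omega
  refine ⟨(Equiv.ofBijective _ hbij).trans t, fun b b' => ?_, fun b b' => ?_⟩
  · simpa [row] using hrow b b'
  · simpa [col] using hcol b b'

variable {k m : ℕ} {μ : YoungDiagram} {t : YoungTableau μ m} {e : Fin (k + 1) ⊕ Fin k ≃ Fin m}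

theorem finiteDimensional_multilinear (e : Fin (k + 1) ⊕ Fin k ≃ Fin m) (hk : 1 ≤ k) :
    FiniteDimensional ℂ (multilinear (k + 1) (Fin m)).toSubmodule := by
  rw [multilinear_eq_span_pairWord hk (by
    rw [← Fintype.card_congr e, Fintype.card_sum, Fintype.card_fin, Fintype.card_fin]; omega)]
  exact FiniteDimensional.span_of_finite ℂ (Set.finite_range _)

/-- The intertwining map `y ↦ y · w` from the Specht module to the multilinear component of the
free LAnKe, for `w` the word `pairWord` read off the columns of the tableau. -/
def spechtToLie (t : YoungTableau μ m) (e : Fin (k + 1) ⊕ Fin k ≃ Fin m) :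
    t.specht.toSubmodule →ₗ[ℂ] (multilinear (k + 1) (Fin m)).toSubmodule :=
  pairing (fun σ : Equiv.Perm (Fin m) => pairVec (e.trans σ)) ∘ₗ t.specht.toSubmodule.subtype

theorem spechtToLie_injective (he : t.IsLabelling e) :
    Function.Injective (spechtToLie t e) := by
  rw [← LinearMap.ker_eq_bot, LinearMap.ker_eq_bot']
  rintro ⟨y, hy⟩ h
  refine Subtype.ext (eq_zero_of_pairing_pairWord_eq_zero he hy ?_)
  have h' := congrArg Subtype.val h
  simp only [spechtToLie, LinearMap.comp_apply, Submodule.subtype_apply, pairing_eq_sum,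
    AddSubmonoidClass.coe_finsetSum, Submodule.coe_smul] at h'
  rw [pairing_eq_sum]
  exact h'

theorem spechtToLie_intertwining (σ : Equiv.Perm (Fin m)) :
    spechtToLie t e ∘ₗ t.spechtRep σ = lieRep (k + 1) m σ ∘ₗ spechtToLie t e := by
  have key : pairing (fun τ : Equiv.Perm (Fin m) => pairVec (e.trans τ)) ∘ₗ
      Representation.leftRegular ℂ (Equiv.Perm (Fin m)) σ =
      lieRep (k + 1) m σ ∘ₗ pairing (fun τ : Equiv.Perm (Fin m) => pairVec (e.trans τ)) := by
    have h : ∀ y, (pairing (fun τ : Equiv.Perm (Fin m) => pairVec (e.trans τ)) ∘ₗ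
        Representation.leftRegular ℂ (Equiv.Perm (Fin m)) σ) y =
        (lieRep (k + 1) m σ ∘ₗ
          pairing (fun τ : Equiv.Perm (Fin m) => pairVec (e.trans τ))) y := by
      intro y
      induction y using MonoidAlgebra.induction_linear with
      | zero => rw [map_zero, map_zero]
      | add a b ha hb => rw [map_add, map_add, ha, hb]
      | single τ c =>
        rw [LinearMap.comp_apply, LinearMap.comp_apply]
        simp only [Representation.ofMulAction_single, pairing_single, map_smul, smul_eq_mul]
        congr 1
        exact Subtype.ext (permRep_pairWord σ (τ ∘ e)).symm
    exact LinearMap.ext h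
  ext1 y
  exact LinearMap.congr_fun key y.1

/-- The cycle of three inequalities closes here, so all three dimensions agree. -/
theorem finrank_specht_eq (he : t.IsLabelling e) (hk : 1 ≤ k) :
    Module.finrank ℂ t.specht.toSubmodule = Module.finrank ℂ (harmonic (Fin m) k) ∧
    Module.finrank ℂ (multilinear (k + 1) (Fin m)).toSubmodule =
      Module.finrank ℂ (harmonic (Fin m) k) := by
  have := finiteDimensional_multilinear e hk
  have h1 := LinearMap.finrank_le_finrank_of_injective (spechtToLie_injective he)
  have h2 := finrank_multilinear_le e hk (by
    rw [← Fintype.card_congr e, Fintype.card_sum, Fintype.card_fin, Fintype.card_fin]; omega)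
  have h3 := finrank_harmonic_le_finrank_specht he
  omega

theorem nonempty_lieRep_equiv_spechtRep (he : t.IsLabelling e) (hk : 1 ≤ k) :
    Nonempty ((lieRep (k + 1) m).Equiv t.spechtRep) := by
  have := finiteDimensional_multilinear e hk
  have : FiniteDimensional ℂ t.specht.toSubmodule :=
    FiniteDimensional.span_of_finite ℂ (Set.finite_range _)
  have hdim := finrank_specht_eq he hk
  exact ⟨(Representation.Equiv.mk (LinearEquiv.ofInjectiveOfFinrankEq _ (spechtToLie_injective he)
    (hdim.1.trans hdim.2.symm)) fun σ => spechtToLie_intertwining σ).symm⟩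

end YoungTableau

theorem mainTheorem1 (n : ℕ) (hn : 2 ≤ n) :
    (∀ t : YoungTableau (twoOneDiagram n) (2 * n - 1),
      Nonempty ((lieRep n (2 * n - 1)).Equiv t.spechtRep) ∧
      (Module.finrank ℂ t.specht.toSubmodule : ℚ) = 1 / ((n : ℚ) + 1) * ((2 * n).choose n : ℚ)) ∧
    (Module.finrank ℂ (FreeLAnKe.multilinear n (Fin (2 * n - 1))).toSubmodule : ℚ) =
      1 / ((n : ℚ) + 1) * ((2 * n).choose n : ℚ) := by
  -- The bracket arity is `(k + 1) + 1`, so the preceding results apply with parameter `k + 1 ≥ 1`.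
  obtain ⟨k, rfl⟩ : ∃ k, n = k + 2 := ⟨n - 2, by omega⟩
  have hK := BooleanLattice.finrank_harmonic (α := Fin (2 * (k + 2) - 1)) (k := k)
    (by rw [Fintype.card_fin]; omega)
  refine ⟨fun t => ?_, ?_⟩
  · obtain ⟨e, he⟩ := YoungTableau.exists_isLabelling (k := k + 1) t
    refine ⟨YoungTableau.nonempty_lieRep_equiv_spechtRep he (by omega), ?_⟩
    rw [(YoungTableau.finrank_specht_eq he (by omega)).1]
    exact hK
  -- The lower bound for the multilinear component passes through a Specht module, so some tableau
  -- is needed.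
  · obtain ⟨t⟩ := nonempty_tableau_twoOneDiagram (k + 2) (by omega)
    obtain ⟨e, he⟩ := YoungTableau.exists_isLabelling (k := k + 1) t
    rw [(YoungTableau.finrank_specht_eq he (by omega)).2]
    exact hK

end
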